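/- **Setting.** Let $\mathbb{T}^\infty=\bigcup_{n\ge 0}(\mathbb{N}^*)^n$ be the Ulam–Harris–Neveu tree, with root $\partial$ (the empty word), in which every vertex $u\neq\partial$ is joined to its parent $\mathrm{p}(u)$, obtained by deleting the last letter of $u$. A *subtree* is a finite nonempty set of vertices that induces a connected subgraph (it need not contain $\partial$). It is a *line graph* if this induced subgraph is a path. Let $Q$ be a Markov kernel on a measurable space $\mathcal{X}$, and let $\mu$ be a probability measure on $\mathcal{X}$ that is invariant for $Q$. Assume that the operator $Qf(x)=\int f(y)\,Q(x;\mathrm{d}y)$ induced by $Q$ on the real space $L^2(\mu)$ is self-adjoint (i.e. $Q$ is reversible with respect to $\mu$) and compact. Let $X=(X_u)_{u\in\mathbb{T}^\infty}$ be a branching Markov process with transition kernel $Q$ and initial distribution $\mu$: for every subtree $T$ containing $\partial$, $$\mathbb{P}(X_u\in \mathrm{d}x_u,\ u\in T)=\mu(\mathrm{d}x_\partial)\prod_{u\in T\setminus\{\partial\}}Q(x_{\mathrm{p}(u)};\mathrm{d}x_u).$$ Let $f\in L^2(\mu)$ be real-valued and, for a finite nonempty $A\subset\mathbb{T}^\infty$,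 let $\bar M_A(f)=|A|^{-1}\sum_{u\in A}f(X_u)$. **Proposition.** 1. For every finite nonempty $A\subset\mathbb{T}^\infty$, $\bar M_A(f)$ is square integrable and $\mathbb{E}[\bar M_A(f)]=\int f\,\mathrm{d}\mu$, so the empirical average is an unbiased estimator. 2. For every $n\ge 1$, among all subtrees $A$ with $n$ vertices, the variance $\operatorname{Var}(\bar M_A(f))$ is minimized by the line graph: every subtree with $n$ vertices that is a line graph is a minimizer, in particular the Markov chain $\{\partial,1,11,\dots,1^{n-1}\}$. 3. For every $n\ge 5$, the line graph is, up to graph isomorphism, the only minimizer of $\operatorname{Var}(\bar M_A(f))$ among subtrees $A$ with $n$ vertices (that is, every minimizer is a line graph) if and only if $$f\notin \operatorname{Ker}(Q)\oplus\operatorname{Ker}(Q-I)\oplus\operatorname{Ker}(Q+I),$$ where the kernels are those of operators on $L^2(\mu)$. -/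

import Mathlib

open MeasureTheory ProbabilityTheory
open scoped ENNReal

noncomputable section

/-! ### The Ulam-Harris-Neveu tree -/

/-- Vertices of the Ulam-Harris-Neveu tree: finite words over the positive integers. -/
abbrev UHN : Type := List ℕ+

namespace UHN

/-- The root is the empty word. -/
def root : UHN := []

/-- The parent of a nonempty word, obtained by deleting its last letter
(the value at the root is never used). -/
def parent (u : UHN) : UHN := u.dropLast

/-- The graph of the tree: every vertex other than the root is joined to its parent. -/
def graph : SimpleGraph UHN :=
  SimpleGraph.fromRel fun u v => u ≠ root ∧ parent u = v

/-- A finite set of vertices is a subtree if it induces a connected (in particular nonempty)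
subgraph of the tree. It need not contain the root. -/
def IsSubtree (A : Finset UHN) : Prop :=
  (graph.induce (A : Set UHN)).Connected

/-- The subtrees with `n` vertices. -/
def subtreesOfCard (n : ℕ) : Set (Finset UHN) :=
  {A | IsSubtree A ∧ A.card = n}

/-- `A` is, as a graph, a line (path) graph. -/
def IsLine (A : Finset UHN) : Prop :=
  Nonempty (graph.induce (A : Set UHN) ≃g SimpleGraph.pathGraph A.card)

/-- The first `n` vertices `∂, 1, 11, 111, …` of the leftmost branch; the branching process
restricted to this branch is the Markov chain. -/
def markovLine (n : ℕ) : Finset UHN :=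
  (Finset.range n).image fun k => List.replicate k (1 : ℕ+)

/-- `Explores l T`: the list `l`, read from its last entry to its first one, enumerates the
vertices of `T` other than the root, each vertex once and after its parent. -/
inductive Explores : List UHN → Finset UHN → Prop
  | root : Explores [] {UHN.root}
  | graft {l : List UHN} {T : Finset UHN} {v : UHN} :
      Explores l T → v ∉ T → parent v ∈ T → Explores (v :: l) (insert v T)

end UHN

/-! ### Branching Markov processes -/

section Branching

variable {𝓧 : Type*} [MeasurableSpace 𝓧]

/-- Given the values `x`, replace the value at the vertex `v` by a random one, drawn from
`Q (x (parent v))`. -/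
def branchStep (Q : Kernel 𝓧 𝓧) (v : UHN) : Kernel (UHN → 𝓧) (UHN → 𝓧) :=
  (Kernel.id ×ₖ Q.comap (fun x : UHN → 𝓧 => x (UHN.parent v)) (measurable_pi_apply _)).map
    fun p => Function.update p.1 v p.2

theorem measurable_branchUpdate (v : UHN) :
    Measurable fun p : (UHN → 𝓧) × 𝓧 => Function.update p.1 v p.2 :=
  measurable_update'

instance (Q : Kernel 𝓧 𝓧) [IsMarkovKernel Q] (v : UHN) : IsMarkovKernel (branchStep Q v) :=
  Kernel.IsMarkovKernel.map _ (measurable_branchUpdate v)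

/-- The vertices of `l` receive their values one after the other, from the last entry of `l` to
the first one: the root has law `ν`, and `v` is drawn from `Q (x (parent v))`. When `l` explores
`T`, the marginal on `T` is `ν(dx_∂) ∏_{u ∈ T, u ≠ ∂} Q(x_{p(u)}; dx_u)`. The coordinates outside
of `T` just hold a copy of the root value and are discarded below. -/
def branchLaw (ν : Measure 𝓧) (Q : Kernel 𝓧 𝓧) : List UHN → Measure (UHN → 𝓧)
  | [] => ν.map fun x _ => x
  | v :: l => (branchLaw ν Q l).bind (branchStep Q v)

/-- `X` is a branching Markov process with transition kernel `Q` and initial distribution `ν`: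
for every finite subtree `T` containing the root,
`P(X_u ∈ dx_u, u ∈ T) = ν(dx_∂) ∏_{u ∈ T, u ≠ ∂} Q(x_{p(u)}; dx_u)`. -/
structure IsBranchingMarkovProcess {Ω : Type*} [MeasurableSpace Ω] (P : Measure Ω)
    (X : UHN → Ω → 𝓧) (Q : Kernel 𝓧 𝓧) (ν : Measure 𝓧) : Prop where
  measurable : ∀ u, Measurable (X u)
  law : ∀ (T : Finset UHN) (l : List UHN), UHN.IsSubtree T → UHN.root ∈ T → UHN.Explores l T →
    P.map (fun ω (u : T) => X u ω) = (branchLaw ν Q l).map (fun x (u : T) => x u)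

/-- The empirical average `|A|⁻¹ ∑_{u ∈ A} f(X_u)`. -/
def empiricalAverage {Ω : Type*} (X : UHN → Ω → 𝓧) (f : 𝓧 → ℝ) (A : Finset UHN) : Ω → ℝ :=
  fun ω => (A.card : ℝ)⁻¹ * ∑ u ∈ A, f (X u ω)

end Branching

/-! ### The operator induced on `L²(μ)` by a Markov kernel with invariant measure `μ` -/

section Operator

variable {𝓧 : Type*} [MeasurableSpace 𝓧] {μ : Measure 𝓧} {Q : Kernel 𝓧 𝓧}

/-- `(Q f)(x) = ∫ f(y) Q(x; dy)`. -/
def kernelAverage (Q : Kernel 𝓧 𝓧) (f : 𝓧 → ℝ) : 𝓧 → ℝ := fun x => ∫ y, f y ∂(Q x)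

theorem ae_ae_of_invariant (hQ : Kernel.Invariant Q μ) {p : 𝓧 → Prop}
    (h : ∀ᵐ y ∂μ, p y) : ∀ᵐ x ∂μ, ∀ᵐ y ∂(Q x), p y := by
  apply Measure.ae_ae_of_ae_bind Q.aemeasurable
  rwa [hQ.def]

theorem kernelAverage_congr (hQ : Kernel.Invariant Q μ) {f g : 𝓧 → ℝ} (h : f =ᵐ[μ] g) :
    kernelAverage Q f =ᵐ[μ] kernelAverage Q g := by
  filter_upwards [ae_ae_of_invariant hQ h] with x hx
  exact integral_congr_ae hx

theorem aestronglyMeasurable_kernelAverage [IsMarkovKernel Q] (hQ : Kernel.Invariant Q μ)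
    {f : 𝓧 → ℝ} (hf : AEStronglyMeasurable f μ) :
    AEStronglyMeasurable (kernelAverage Q f) μ :=
  ⟨kernelAverage Q (hf.mk f),
    StronglyMeasurable.integral_kernel (κ := Q) hf.stronglyMeasurable_mk,
    kernelAverage_congr hQ hf.ae_eq_mk⟩

theorem lintegral_kernel_of_invariant (hQ : Kernel.Invariant Q μ) {g : 𝓧 → ℝ≥0∞}
    (hg : AEMeasurable g μ) : ∫⁻ x, ∫⁻ y, g y ∂(Q x) ∂μ = ∫⁻ y, g y ∂μ := by
  rw [← Measure.lintegral_bind Q.aemeasurable (by rwa [hQ.def]), hQ.def]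

theorem eLpNorm_kernelAverage_le [IsMarkovKernel Q] (hQ : Kernel.Invariant Q μ)
    {f : 𝓧 → ℝ} (hf : AEStronglyMeasurable f μ) :
    eLpNorm (kernelAverage Q f) 2 μ ≤ eLpNorm f 2 μ := by
  have key : ∀ᵐ x ∂μ, ‖kernelAverage Q f x‖ₑ ^ (2 : ℝ) ≤ ∫⁻ y, ‖f y‖ₑ ^ (2 : ℝ) ∂(Q x) := by
    filter_upwards [ae_ae_of_invariant hQ hf.ae_eq_mk] with x hx
    have hfx : AEStronglyMeasurable f (Q x) := ⟨_, hf.stronglyMeasurable_mk, hx⟩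
    have h1 : ‖kernelAverage Q f x‖ₑ ≤ eLpNorm f 2 (Q x) := by
      refine (enorm_integral_le_lintegral_enorm f).trans ?_
      rw [← eLpNorm_one_eq_lintegral_enorm]
      exact eLpNorm_le_eLpNorm_of_exponent_le (by norm_num) hfx
    calc ‖kernelAverage Q f x‖ₑ ^ (2 : ℝ) ≤ (eLpNorm f 2 (Q x)) ^ (2 : ℝ) := by gcongr
      _ = ∫⁻ y, ‖f y‖ₑ ^ (2 : ℝ) ∂(Q x) := by
        rw [eLpNorm_eq_lintegral_rpow_enorm_toReal (by norm_num) (by norm_num),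
          ← ENNReal.rpow_mul]
        simp
  rw [eLpNorm_eq_lintegral_rpow_enorm_toReal (by norm_num) (by norm_num),
    eLpNorm_eq_lintegral_rpow_enorm_toReal (by norm_num) (by norm_num)]
  refine ENNReal.rpow_le_rpow ?_ (by positivity)
  simp only [ENNReal.toReal_ofNat]
  calc ∫⁻ x, ‖kernelAverage Q f x‖ₑ ^ (2 : ℝ) ∂μ
      ≤ ∫⁻ x, ∫⁻ y, ‖f y‖ₑ ^ (2 : ℝ) ∂(Q x) ∂μ := lintegral_mono_ae key
    _ = _ := lintegral_kernel_of_invariant hQ (hf.enorm.pow_const _)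

theorem memLp_kernelAverage [IsMarkovKernel Q] (hQ : Kernel.Invariant Q μ)
    {f : 𝓧 → ℝ} (hf : MemLp f 2 μ) : MemLp (kernelAverage Q f) 2 μ :=
  ⟨aestronglyMeasurable_kernelAverage hQ hf.1,
    (eLpNorm_kernelAverage_le hQ hf.1).trans_lt hf.2⟩

theorem ae_integrable_kernel [IsMarkovKernel Q] (hQ : Kernel.Invariant Q μ)
    {f : 𝓧 → ℝ} (hf : MemLp f 2 μ) : ∀ᵐ x ∂μ, Integrable f (Q x) := by
  have hm : AEMeasurable (fun y => ‖f y‖ₑ ^ (2 : ℝ)) μ := hf.1.enorm.pow_const _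
  have hfin : ∫⁻ x, ∫⁻ y, ‖f y‖ₑ ^ (2 : ℝ) ∂(Q x) ∂μ ≠ ∞ := by
    rw [lintegral_kernel_of_invariant hQ hm]
    have := lintegral_rpow_enorm_lt_top_of_eLpNorm_lt_top (p := 2) (by norm_num) (by norm_num) hf.2
    simpa using this.ne
  have hm2 : AEMeasurable (fun x => ∫⁻ y, ‖f y‖ₑ ^ (2 : ℝ) ∂(Q x)) μ := by
    refine ⟨fun x => ∫⁻ y, hm.mk _ y ∂(Q x), hm.measurable_mk.lintegral_kernel, ?_⟩
    filter_upwards [ae_ae_of_invariant hQ hm.ae_eq_mk] with x hx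
    exact lintegral_congr_ae hx
  filter_upwards [ae_lt_top' hm2 hfin, ae_ae_of_invariant hQ hf.1.ae_eq_mk] with x hx hfx
  have : MemLp f 2 (Q x) := by
    refine ⟨⟨_, hf.1.stronglyMeasurable_mk, hfx⟩, ?_⟩
    rw [eLpNorm_eq_lintegral_rpow_enorm_toReal (by norm_num) (by norm_num)]
    exact ENNReal.rpow_lt_top_of_nonneg (by positivity) (by simpa using hx.ne)
  exact this.integrable (by norm_num)

/-- The bounded operator `f ↦ Q f` on `L²(μ)`, for a Markov kernel `Q` with invariant
measure `μ`. -/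
def kernelOperator (Q : Kernel 𝓧 𝓧) [IsMarkovKernel Q] (μ : Measure 𝓧)
    (hQ : Kernel.Invariant Q μ) : Lp ℝ 2 μ →L[ℝ] Lp ℝ 2 μ :=
  LinearMap.mkContinuous
    { toFun := fun f => (memLp_kernelAverage hQ (Lp.memLp f)).toLp (kernelAverage Q f)
      map_add' := by
        intro f g
        rw [← MemLp.toLp_add, MemLp.toLp_eq_toLp_iff]
        filter_upwards [kernelAverage_congr hQ (Lp.coeFn_add f g),
          ae_integrable_kernel hQ (Lp.memLp f), ae_integrable_kernel hQ (Lp.memLp g)]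
          with x h1 hf hg
        rw [h1]
        exact integral_add hf hg
      map_smul' := by
        intro c f
        rw [RingHom.id_apply, ← MemLp.toLp_const_smul, MemLp.toLp_eq_toLp_iff]
        filter_upwards [kernelAverage_congr hQ (Lp.coeFn_smul c f)] with x h1
        rw [h1]
        exact integral_const_mul c _ }
    1 (by
      intro f
      rw [one_mul, LinearMap.coe_mk, AddHom.coe_mk, Lp.norm_toLp, Lp.norm_def]
      exact ENNReal.toReal_mono (Lp.memLp f).2.ne
        (eLpNorm_kernelAverage_le hQ (Lp.memLp f).1))

end Operator

end

/-! Reversibility and the branching property give `E[f(X_u) f(X_v)] = ⟨f, Q ^ d(u, v) f⟩`, so the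
variance is `|A|⁻² ⟨f, p_A(Q) f⟩ - (∫ f)²` with `p_A(a) = ∑_{u, v ∈ A} a ^ d(u, v)`. As `Q` is a
compact self-adjoint contraction, everything reduces to comparing `p_A` with the polynomial `p_L` of
a line on `[-1, 1]`. The inequality `p_L ≤ p_A` gives minimality (`inner_aeval_nonneg`). If `A` is
not a line, the inequality is strict off `{-1, 0, 1}`, which gives uniqueness as soon as `f` has a
component along an eigenvector with another eigenvalue (`inner_aeval_pos`). If `f` has none, only
the values at `-1, 0, 1` matter, and some tree other than a line ties with the line there
(`exists_not_isLine`).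

The core is `pairSum_path_le`. For `0 < a ≤ 1` an induction over the cutting of edges suffices,
since pair sums and root sums are both least for a path hung by its end. At `a = -1` the sum is the
square of the difference of the two bipartition classes.

For `-1 < a < 0` the cross term `2 a r_t r_s` rewards large products of root sums, so the pair sums
of the two pieces cannot be minimized separately. Instead one minimizes the energy `pairSum + 2 a φ
rootSum` of a tree hanging from a vertex of weight `φ`; the field felt by a branch is again a number
(`energy_graft`), so branches can be replaced one by one. Strong induction on the size proves
`Improves` (`improves_of_size`). Each move of branches changes the energy by an explicit product
whose sign is read off from the fields and root sums.

For uniqueness, delete a leaf. The energy bounds at `φ = 0` and `φ = -1/a` (for `a < 0`) force the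
rest to have the pair sum of a path, and the neighbor of the leaf to have the root sum of an end
(`eq_path_of_pairSum_graft_single`). By induction the rest is a line, and the leaf prolongs it. -/

/-! ### Rooted trees and their distance generating functions -/

/-- Finite rooted trees: `graft t s` hangs the root of `s` below the root of `t`. -/
inductive BranchTree : Type
  | single : BranchTree
  | graft : BranchTree → BranchTree → BranchTree

namespace BranchTree

/-- The number of vertices. -/
def size : BranchTree → ℕ
  | single => 1
  | graft t s => size t + size s

/-- `∑ a ^ d(root, u)` over the vertices `u`. -/
noncomputable def rootSum (a : ℝ) : BranchTree → ℝ
  | single => 1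
  | graft t s => rootSum a t + a * rootSum a s

/-- `∑ a ^ d(u, v)` over the ordered pairs of vertices `u, v`. -/
noncomputable def pairSum (a : ℝ) : BranchTree → ℝ
  | single => 1
  | graft t s => pairSum a t + pairSum a s + 2 * a * rootSum a t * rootSum a s

/-- The contribution of a tree whose root is joined to an outer vertex of weight `φ`. -/
noncomputable def energy (a φ : ℝ) (t : BranchTree) : ℝ :=
  pairSum a t + 2 * a * φ * rootSum a t

/-- The path on `k + 1` vertices, rooted at an end. -/
def path : ℕ → BranchTree
  | 0 => single
  | k + 1 => graft single (path k)

/-- Hang all the trees of a list below the root of `t`. -/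
def attach (t : BranchTree) : List BranchTree → BranchTree
  | [] => t
  | s :: l => graft (attach t l) s

/-- Put `t` below the last vertex of a path with `k + 1` vertices. -/
def prolong (t : BranchTree) : ℕ → BranchTree
  | 0 => graft single t
  | k + 1 => graft single (prolong t k)

theorem size_pos : ∀ t : BranchTree, 0 < size t
  | single => Nat.one_pos
  | graft t _ => Nat.add_pos_left (size_pos t) _

@[simp] theorem size_path (k : ℕ) : size (path k) = k + 1 := by
  induction k with
  | zero => rfl
  | succ k ih => simp only [path, size, ih]; omega

theorem exists_attach : ∀ t : BranchTree, ∃ l, t = attach single l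
  | single => ⟨[], rfl⟩
  | graft t s => by
    obtain ⟨l, hl⟩ := exists_attach t
    exact ⟨s :: l, by rw [attach, ← hl]⟩

theorem size_attach (t : BranchTree) (l : List BranchTree) :
    size (attach t l) = size t + (l.map size).sum := by
  induction l with
  | nil => rfl
  | cons s l ih => simp only [attach, size, ih, List.map_cons, List.sum_cons]; omega

theorem rootSum_attach (a : ℝ) (t : BranchTree) (l : List BranchTree) :
    rootSum a (attach t l) = rootSum a t + a * (l.map (rootSum a)).sum := by
  induction l with
  | nil => simp [attach]
  | cons s l ih => simp only [attach, rootSum, ih, List.map_cons, List.sum_cons]; ring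

/-- Vertices in two distinct branches `s`, `s'` contribute `a ^ 2 * rootSum a s * rootSum a s'`.
Completing the square makes the result visibly symmetric in the list, whence the permutation lemmas
below. -/
theorem pairSum_attach (a : ℝ) (t : BranchTree) (l : List BranchTree) :
    pairSum a (attach t l) = pairSum a t + 2 * a * rootSum a t * (l.map (rootSum a)).sum
      + a ^ 2 * (l.map (rootSum a)).sum ^ 2
      + (l.map fun s => pairSum a s - a ^ 2 * rootSum a s ^ 2).sum := by
  induction l with
  | nil => simp [attach]
  | cons s l ih =>
    simp only [attach, pairSum, ih, List.map_cons, List.sum_cons, rootSum_attach]; ring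

theorem size_attach_perm (t : BranchTree) {l l' : List BranchTree} (h : l.Perm l') :
    size (attach t l) = size (attach t l') := by
  rw [size_attach, size_attach, (h.map size).sum_eq]

theorem rootSum_attach_perm (a : ℝ) (t : BranchTree) {l l' : List BranchTree} (h : l.Perm l') :
    rootSum a (attach t l) = rootSum a (attach t l') := by
  rw [rootSum_attach, rootSum_attach, (h.map _).sum_eq]

theorem pairSum_attach_perm (a : ℝ) (t : BranchTree) {l l' : List BranchTree} (h : l.Perm l') :
    pairSum a (attach t l) = pairSum a (attach t l') := by
  rw [pairSum_attach, pairSum_attach, (h.map (rootSum a)).sum_eq,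
    (h.map fun s => pairSum a s - a ^ 2 * rootSum a s ^ 2).sum_eq]

theorem energy_attach_perm (a φ : ℝ) (t : BranchTree) {l l' : List BranchTree}
    (h : l.Perm l') : energy a φ (attach t l) = energy a φ (attach t l') := by
  rw [energy, energy, pairSum_attach_perm a t h, rootSum_attach_perm a t h]

/-- The branch `s` feels the rest of the tree only through the weight accumulated at the root of
`t`, namely the vertices of `t` and the outer vertex, discounted by distance. Hence `s` can be
optimized for this field alone. -/
theorem energy_graft (a φ : ℝ) (t s : BranchTree) :
    energy a φ (graft t s) = energy a φ t + energy a (rootSum a t + a * φ) s := by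
  simp only [energy, pairSum, rootSum]; ring

theorem one_sub_mul_rootSum_path (a : ℝ) (k : ℕ) :
    (1 - a) * rootSum a (path k) = 1 - a ^ (k + 1) := by
  induction k with
  | zero => simp [path, rootSum]
  | succ k ih => simp only [path, rootSum, pow_succ] at *; linear_combination a * ih

theorem rootSum_path_add (a : ℝ) (i j : ℕ) :
    rootSum a (path (i + j + 1)) = rootSum a (path i) + a ^ (i + 1) * rootSum a (path j) := by
  induction i with
  | zero => simp [path, rootSum]
  | succ i ih =>
    rw [show i + 1 + j + 1 = (i + j + 1) + 1 by ring]
    change rootSum a (graft single (path (i + j + 1))) = rootSum a (graft single (path i)) + _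
    simp only [rootSum, ih]; ring

theorem pairSum_path_add (a : ℝ) (i j : ℕ) :
    pairSum a (path (i + j + 1)) = pairSum a (path i) + pairSum a (path j)
      + 2 * a * rootSum a (path i) * rootSum a (path j) := by
  induction i with
  | zero => simp [path, rootSum, pairSum]
  | succ i ih =>
    rw [show i + 1 + j + 1 = (i + j + 1) + 1 by ring]
    change pairSum a (graft single (path (i + j + 1))) = pairSum a (graft single (path i)) + _
      + 2 * a * rootSum a (graft single (path i)) * _
    simp only [rootSum, pairSum, ih, rootSum_path_add]
    linear_combination (2 * a * rootSum a (path j)) * one_sub_mul_rootSum_path a i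

theorem size_prolong (t : BranchTree) (k : ℕ) : size (prolong t k) = size t + k + 1 := by
  induction k with
  | zero => simp only [prolong, size]; omega
  | succ k ih => simp only [prolong, size, ih]; omega

theorem rootSum_prolong (a : ℝ) (t : BranchTree) (k : ℕ) :
    rootSum a (prolong t k) = rootSum a (path k) + a ^ (k + 1) * rootSum a t := by
  induction k with
  | zero => simp [prolong, path, rootSum]
  | succ k ih => simp only [prolong, path, rootSum, ih]; ring

theorem pairSum_prolong (a : ℝ) (t : BranchTree) (k : ℕ) :
    pairSum a (prolong t k) = pairSum a (path k) + pairSum a t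
      + 2 * a * rootSum a (path k) * rootSum a t := by
  induction k with
  | zero => simp [prolong, path, rootSum, pairSum]
  | succ k ih =>
    simp only [prolong, path, rootSum, pairSum, ih, rootSum_prolong]
    linear_combination (2 * a * rootSum a t) * one_sub_mul_rootSum_path a k

/-! ### Energy changes under rearrangements, for `-1 < a < 0` -/

section Negative

variable {a : ℝ}

/-- The map `x ↦ 1 + a * x` sends `[0, 1]` into itself. -/
theorem rootSum_path_mem (h1 : -1 < a) (h0 : a < 0) (k : ℕ) :
    0 ≤ rootSum a (path k) ∧ rootSum a (path k) ≤ 1 := by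
  induction k with
  | zero => simp [path, rootSum]
  | succ k ih =>
    simp only [path, rootSum]
    constructor <;> nlinarith [ih.1, ih.2]

/-- Moving a branch `s` from the root to a child of the root. -/
theorem energy_merge_le (h0 : a < 0) (φ : ℝ) (t s s' : BranchTree)
    (h : 0 ≤ rootSum a s * (rootSum a s' - (rootSum a t + a * φ))) :
    energy a φ (graft t (graft s' s)) ≤ energy a φ (graft (graft t s') s) := by
  have key : energy a φ (graft t (graft s' s)) - energy a φ (graft (graft t s') s)
      = 2 * a * (1 - a) * (rootSum a s * (rootSum a s' - (rootSum a t + a * φ))) := by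
    simp only [energy, pairSum, rootSum]; ring
  have : 2 * a * (1 - a) ≤ 0 := by nlinarith
  nlinarith [mul_nonneg_of_nonpos_of_nonpos this (neg_nonpos.2 h)]

/-- Moving branches from the root to a leaf at distance two. -/
theorem energy_merge_leaf_le (h1 : -1 < a) (h0 : a < 0) (φ : ℝ) (t c : BranchTree)
    (l : List BranchTree) (hl : 0 ≤ (l.map (rootSum a)).sum) (h : rootSum a t + a * φ ≤ 1) :
    energy a φ (graft t (graft c (attach single l))) ≤
      energy a φ (graft (attach t l) (graft c single)) := by
  have key : energy a φ (graft t (graft c (attach single l)))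
        - energy a φ (graft (attach t l) (graft c single))
      = 2 * a * (1 - a ^ 2) * ((l.map (rootSum a)).sum * (1 - (rootSum a t + a * φ))) := by
    simp only [energy, pairSum, rootSum, rootSum_attach, pairSum_attach]; ring
  have h2 : 2 * a * (1 - a ^ 2) ≤ 0 := by nlinarith
  have h3 := mul_nonneg hl (sub_nonneg.2 h)
  nlinarith [mul_nonneg_of_nonpos_of_nonpos h2 (neg_nonpos.2 h3)]

/-- Moving all the branches of the root to the end of a path. -/
theorem energy_prolong_le (h1 : -1 < a) (h0 : a < 0) {φ : ℝ} (hφ : 0 ≤ φ) (t : BranchTree)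
    (k : ℕ) (ht : rootSum a t ≤ 1) :
    energy a φ (prolong t k) ≤ energy a φ (graft t (path k)) := by
  have key : energy a φ (prolong t k) - energy a φ (graft t (path k))
      = 2 * a * φ * ((1 - a ^ (k + 1)) * (1 - rootSum a t)) := by
    simp only [energy, rootSum_prolong, pairSum_prolong, pairSum, rootSum]
    linear_combination (2 * a * φ) * one_sub_mul_rootSum_path a k
  have h2 : 0 ≤ (1 - a ^ (k + 1)) := by
    have : |a ^ (k + 1)| ≤ 1 := by
      rw [abs_pow]; exact pow_le_one₀ (abs_nonneg a) (abs_le.2 ⟨h1.le, by linarith⟩)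
    linarith [(abs_le.1 this).2]
  have h3 := mul_nonneg h2 (sub_nonneg.2 ht)
  have h4 : 2 * a * φ ≤ 0 := by nlinarith
  nlinarith [mul_nonneg_of_nonpos_of_nonpos h4 (neg_nonpos.2 h3)]

/-- Moving the children of `c` to the root makes `c` a leaf. -/
theorem energy_lift_le (h0 : a < 0) (φ : ℝ) (t : BranchTree)
    (l : List BranchTree) (hu : 0 ≤ (l.map (rootSum a)).sum) (h : 1 ≤ rootSum a t + a * φ) :
    energy a φ (graft (attach t l) single) ≤ energy a φ (graft t (attach single l)) := by
  have key : energy a φ (graft (attach t l) single) - energy a φ (graft t (attach single l))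
      = 2 * a * (1 - a) * ((l.map (rootSum a)).sum * (rootSum a t + a * φ - 1)) := by
    simp only [energy, pairSum, rootSum, rootSum_attach, pairSum_attach]; ring
  have h2 : 2 * a * (1 - a) ≤ 0 := by nlinarith
  have h3 := mul_nonneg hu (sub_nonneg.2 h)
  nlinarith [mul_nonneg_of_nonpos_of_nonpos h2 (neg_nonpos.2 h3)]

/-- Moving a leaf from a grandchild of the root to the root. -/
theorem energy_lift_leaf_le (h1 : -1 < a) (h0 : a < 0) (φ : ℝ) (t c d : BranchTree)
    (h : rootSum a d ≤ rootSum a t + a * φ) :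
    energy a φ (graft (graft t (graft c d)) single) ≤
      energy a φ (graft t (graft c (graft d single))) := by
  have key : energy a φ (graft (graft t (graft c d)) single)
        - energy a φ (graft t (graft c (graft d single)))
      = 2 * a * (1 - a ^ 2) * (rootSum a t + a * φ - rootSum a d) := by
    simp only [energy, pairSum, rootSum]; ring
  have h2 : 2 * a * (1 - a ^ 2) ≤ 0 := by nlinarith
  nlinarith [mul_nonneg_of_nonpos_of_nonpos h2 (neg_nonpos.2 (sub_nonneg.2 h))]

/-- Merging two paths that hang below the root. -/
theorem energy_two_paths_le (h1 : -1 < a) (h0 : a < 0) (φ : ℝ) (t : BranchTree) (i j : ℕ)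
    (h : rootSum a t + a * φ ≤ 1) :
    energy a φ (graft t (path (i + j + 1))) ≤ energy a φ (graft (graft t (path j)) (path i)) := by
  have key : energy a φ (graft t (path (i + j + 1)))
        - energy a φ (graft (graft t (path j)) (path i))
      = 2 * a * (rootSum a (path j) * ((1 - a ^ (i + 1)) * (1 - (rootSum a t + a * φ)))) := by
    simp only [energy, pairSum, rootSum, rootSum_path_add, pairSum_path_add]
    linear_combination (2 * a * rootSum a (path j)) * one_sub_mul_rootSum_path a i
  have h2 : 0 ≤ 1 - a ^ (i + 1) := by
    rw [← one_sub_mul_rootSum_path]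
    exact mul_nonneg (by linarith) (rootSum_path_mem h1 h0 i).1
  have h3 := mul_nonneg (rootSum_path_mem h1 h0 j).1 (mul_nonneg h2 (sub_nonneg.2 h))
  nlinarith

/-- Shortening one of two paths that hang below the root to a leaf. -/
theorem energy_two_paths_leaf_le (h1 : -1 < a) (h0 : a < 0) (φ : ℝ) (t : BranchTree) (i j : ℕ)
    (h : 1 ≤ rootSum a t + a * φ) :
    energy a φ (graft (graft t (path (i + j))) single) ≤
      energy a φ (graft (graft t (path j)) (path i)) := by
  have hP : pairSum a (path (i + j + 1)) = 1 + pairSum a (path (i + j))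
      + 2 * a * rootSum a (path (i + j)) := by simp only [path, pairSum, rootSum]; ring
  have ei := one_sub_mul_rootSum_path a i
  have ej := one_sub_mul_rootSum_path a j
  have eij := one_sub_mul_rootSum_path a (i + j)
  have hP' := pairSum_path_add a i j
  have key : (1 - a) * (energy a φ (graft (graft t (path j)) (path i))
        - energy a φ (graft (graft t (path (i + j))) single))
      = 2 * a ^ 2 * ((1 - a ^ i) * (1 - a ^ j) * (rootSum a t + a * φ - 1)) := by
    have hne : (1 - a) ≠ 0 := by linarith
    have vi : rootSum a (path i) = (1 - a ^ (i + 1)) / (1 - a) := by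
      rw [← ei]; field_simp
    have vj : rootSum a (path j) = (1 - a ^ (j + 1)) / (1 - a) := by
      rw [← ej]; field_simp
    have vij : rootSum a (path (i + j)) = (1 - a ^ (i + j + 1)) / (1 - a) := by
      rw [← eij]; field_simp
    -- `hP` and `hP'` cut the same path at its first edge and between the two pieces; equating them
    -- eliminates the pair sum of `path (i + j)`.
    have hQ : pairSum a (path (i + j)) = pairSum a (path i) + pairSum a (path j)
      + 2 * a * rootSum a (path i) * rootSum a (path j) - 1
      - 2 * a * rootSum a (path (i + j)) := by linarith
    simp only [energy, pairSum, rootSum, hQ, vi, vj, vij]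
    field_simp
    ring
  have h2 : ∀ k : ℕ, 0 ≤ 1 - a ^ k := fun k => by
    have : |a ^ k| ≤ 1 := by
      rw [abs_pow]; exact pow_le_one₀ (abs_nonneg a) (abs_le.2 ⟨h1.le, by linarith⟩)
    linarith [(abs_le.1 this).2]
  have h3 := mul_nonneg (mul_nonneg (h2 i) (h2 j)) (sub_nonneg.2 h)
  have h4 : 0 ≤ (1 - a) * (energy a φ (graft (graft t (path j)) (path i))
        - energy a φ (graft (graft t (path (i + j))) single)) := by rw [key]; positivity
  have := nonneg_of_mul_nonneg_right h4 (by linarith : (0 : ℝ) < 1 - a)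
  linarith

end Negative

end BranchTree

namespace BranchTree

/-! ### Minimal energy -/

theorem exists_perm_cons_of_mem {α : Type*} {x : α} {l : List α} (h : x ∈ l) :
    ∃ l', l.Perm (x :: l') := by
  obtain ⟨l₁, l₂, rfl⟩ := List.mem_iff_append.1 h
  exact ⟨l₁ ++ l₂, List.perm_middle⟩

theorem exists_neg_of_sum_neg {α : Type*} {l : List α} {g : α → ℝ} (h : (l.map g).sum < 0) :
    ∃ x ∈ l, g x < 0 := by
  by_contra! hc
  refine absurd (List.sum_nonneg ?_) h.not_ge
  simpa using hc

theorem exists_pos_of_sum_pos {α : Type*} {l : List α} {g : α → ℝ} (h : 0 < (l.map g).sum) :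
    ∃ x ∈ l, 0 < g x := by
  by_contra! hc
  have : (l.map g).sum ≤ 0 := by
    clear h
    induction l with
    | nil => simp
    | cons y l ih =>
      rw [List.map_cons, List.sum_cons]
      have := hc y (by simp)
      have := ih fun x hx => hc x (by simp [hx])
      linarith
  exact absurd h this.not_gt

theorem size_lt_of_mem {t s : BranchTree} {l : List BranchTree} (h : s ∈ l) :
    size s < size (attach t l) := by
  rw [size_attach]
  have := List.single_le_sum (l := l.map size) (by simp) _ (List.mem_map_of_mem h)
  have := size_pos t
  omega

theorem prolong_eq_graft (t : BranchTree) (k : ℕ) : ∃ s, prolong t k = graft single s := by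
  cases k <;> exact ⟨_, rfl⟩

theorem energy_graft_right_le (a φ : ℝ) (t : BranchTree) {s s' : BranchTree}
    (h : energy a (rootSum a t + a * φ) s' ≤ energy a (rootSum a t + a * φ) s) :
    energy a φ (graft t s') ≤ energy a φ (graft t s) := by
  rw [energy_graft, energy_graft]; linarith

theorem energy_graft_comm (a φ : ℝ) (t s s' : BranchTree) :
    energy a φ (graft (graft t s) s') = energy a φ (graft (graft t s') s) := by
  simp only [energy, pairSum, rootSum]; ring

/-- In every field `φ ≤ 1`, the tree `s` can be replaced by a path, or, if `φ < 0`, by a tree with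
a leaf below the root. -/
def Improves (a : ℝ) (s : BranchTree) : Prop :=
  ∀ φ ≤ 1, ∃ s', size s' = size s ∧ energy a φ s' ≤ energy a φ s ∧
    ((φ < 0 ∧ ∃ c, s' = graft c single ∧ rootSum a c ≤ 1) ∨ ∃ k, s' = path k)

/-! ### Reduction to paths, for `-1 < a < 0` -/

section Negative

variable {a : ℝ}

/-- If the branches other than some `s` have nonnegative total root sum, then `s` sits in a field at
most 1 and can be improved; the others are moved to the leaf of the improved branch, or to the end
of the path it has become. Otherwise two branches have negative root sums and can be merged, so the
induction runs on the number of negative branches. Of `φ ≥ 0` only `0 ≤ 1 + a * φ` is required, not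
`φ ≤ 1`: the uniqueness argument needs `φ = -1/a`. -/
theorem exists_single_branch (h1 : -1 < a) (h0 : a < 0) {φ : ℝ} (hφ : 0 ≤ φ)
    (hφ' : -(a * φ) ≤ 1) (N : ℕ) : ∀ l : List BranchTree,
    l.countP (fun s => rootSum a s < 0) ≤ N → l ≠ [] →
    (∀ s, size s < size (attach single l) → Improves a s) →
    ∃ s, size s + 1 = size (attach single l) ∧
      energy a φ (graft single s) ≤ energy a φ (attach single l) := by
  induction N with
  | zero | succ N ih => ?_
  all_goals
    intro l hN hl hI
    by_cases h : ∃ s ∈ l, 0 ≤ (l.map (rootSum a)).sum - rootSum a s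
    · obtain ⟨s, hs, ho⟩ := h
      obtain ⟨l', hp⟩ := exists_perm_cons_of_mem hs
      rw [energy_attach_perm a φ single hp, size_attach_perm single hp]
      rw [(hp.map _).sum_eq, List.map_cons, List.sum_cons, add_sub_cancel_left] at ho
      have hF := rootSum_attach a single l'
      simp only [rootSum] at hF
      obtain ⟨s', hs', hE, hc⟩ := hI s (size_lt_of_mem hs)
        (rootSum a (attach single l') + a * φ) (by nlinarith)
      have hE' := energy_graft_right_le a φ (attach single l') hE
      simp only [attach, size, ← hs']
      rcases hc with ⟨-, c, rfl, -⟩ | ⟨k, rfl⟩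
      · refine ⟨graft c (attach single l'), by simp only [size]; omega, le_trans ?_ hE'⟩
        exact energy_merge_leaf_le h1 h0 φ single c l' ho (by simp only [rootSum]; nlinarith)
      · obtain ⟨r, hr⟩ := prolong_eq_graft (attach single l') k
        refine ⟨r, ?_, le_trans ?_ hE'⟩
        · have h2 := size_prolong (attach single l') k
          rw [hr] at h2
          simp only [size] at h2
          rw [size_path]; omega
        · rw [← hr]
          exact energy_prolong_le h1 h0 hφ _ k (by nlinarith)
    · push Not at h
      obtain ⟨s₀, hs₀⟩ := List.exists_mem_of_ne_nil l hl
      have hrest : ∀ s ∈ l, ∃ l' s', l.Perm (s :: s' :: l') ∧ rootSum a s' < 0 ∧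
          rootSum a s' + (l'.map (rootSum a)).sum < 0 := fun s hs => by
        obtain ⟨l₁, hp⟩ := exists_perm_cons_of_mem hs
        have h2 := h s hs
        rw [(hp.map _).sum_eq, List.map_cons, List.sum_cons, add_sub_cancel_left] at h2
        obtain ⟨s', hs', hneg⟩ := exists_neg_of_sum_neg h2
        obtain ⟨l₂, hp₂⟩ := exists_perm_cons_of_mem hs'
        rw [(hp₂.map _).sum_eq, List.map_cons, List.sum_cons] at h2
        exact ⟨l₂, s', hp.trans (hp₂.cons _), hneg, h2⟩
      obtain ⟨_, s, hp₀, hsneg, _⟩ := hrest s₀ hs₀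
      obtain ⟨l', s', hp, hs'neg, hq⟩ := hrest s (hp₀.mem_iff.2 (by simp))
      have hcount := hp.countP_eq (fun s => rootSum a s < 0)
      simp only [List.countP_cons, hsneg, hs'neg, decide_true, if_true] at hcount
      -- In the base case two negative branches contradict the count. In the inductive step `s` is
      -- moved onto `s'`: two negative branches become a single branch, so the count drops.
      first
      | omega
      | have hF := rootSum_attach a single l'
        simp only [rootSum] at hF
        have hm := energy_merge_le h0 φ (attach single l') s s' (by
          refine mul_nonneg_of_nonpos_of_nonpos hsneg.le ?_
          rw [hF]; nlinarith)
        have hsz := size_attach_perm single hp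
        obtain ⟨r, hr, hrE⟩ := ih (graft s' s :: l') (by
            rw [List.countP_cons]; split_ifs <;> omega) (by simp) (by
            intro x hx
            refine hI x ?_
            rw [hsz]
            simp only [attach, size] at hx ⊢; omega)
        refine ⟨r, ?_, hrE.trans ?_⟩
        · rw [hsz, hr]; simp only [attach, size]; omega
        · rw [energy_attach_perm a φ single hp]
          exact hm

/-- A field `R ≥ 1` on a child of the root favors lifting vertices to the root. If the branches of
this child have nonnegative total root sum, they are all lifted and the child becomes a leaf.
Otherwise a negative branch `s` is improved, which yields a leaf to lift or a path, whose root sum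
is nonnegative; or `s` is merged with another negative branch. In the last two cases the number of
negative branches drops. -/
theorem exists_leaf_of_one_le (h1 : -1 < a) (h0 : a < 0) (φ : ℝ) (t : BranchTree)
    (hR : 1 ≤ rootSum a t + a * φ) (N : ℕ) : ∀ l : List BranchTree,
    l.countP (fun s => rootSum a s < 0) ≤ N →
    (∀ s, size s < size (attach single l) → Improves a s) →
    ∃ t', size t' + 1 = size t + size (attach single l) ∧
      energy a φ (graft t' single) ≤ energy a φ (graft t (attach single l)) := by
  induction N with
  | zero | succ N ih => ?_
  all_goals
    intro l hN hI
    rcases le_or_gt 0 (l.map (rootSum a)).sum with hu | hu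
    · refine ⟨attach t l, ?_, energy_lift_le h0 φ t l hu hR⟩
      simp only [size_attach, size]; omega
    obtain ⟨s, hs, hsneg⟩ := exists_neg_of_sum_neg hu
    obtain ⟨l₁, hp⟩ := exists_perm_cons_of_mem hs
    have hcount := hp.countP_eq (fun s => rootSum a s < 0)
    simp only [List.countP_cons, hsneg, decide_true, if_true] at hcount
    first
    | omega
    | set R := rootSum a t + a * φ with hRdef
      have hF := rootSum_attach a single l₁
      simp only [rootSum] at hF
      have hE0 : energy a φ (graft t (attach single l))
          = energy a φ t + energy a R (graft (attach single l₁) s) := by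
        rw [energy_graft, energy_attach_perm a _ single hp]; rfl
      have hsz := size_attach_perm single hp
      simp only [attach, size] at hsz
      -- The field on `s` is `1 + a * (sum over l₁ + R)`, which is at most 1, as `Improves` demands,
      -- exactly when the sum is at least `-R`.
      rcases le_or_gt (-R) (l₁.map (rootSum a)).sum with ho | ho
      · obtain ⟨s', hs', hE, hc⟩ := hI s (size_lt_of_mem hs)
          (rootSum a (attach single l₁) + a * R) (by nlinarith)
        have hE' := energy_graft_right_le a R (attach single l₁) hE
        rcases hc with ⟨-, d, rfl, hd⟩ | ⟨k, rfl⟩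
        · refine ⟨graft t (graft (attach single l₁) d), ?_, ?_⟩
          · simp only [size] at hs' ⊢; omega
          · refine (energy_lift_leaf_le h1 h0 φ t _ d (by linarith)).trans ?_
            rw [energy_graft, hE0]; linarith
        · have hk := (rootSum_path_mem h1 h0 k).1
          obtain ⟨t', ht', hE''⟩ := ih (path k :: l₁) (by
            rw [List.countP_cons, if_neg (by simpa using hk)]; omega) (by
            intro x hx
            refine hI x ?_
            simp only [attach, size] at hx; omega)
          refine ⟨t', ?_, hE''.trans ?_⟩
          · simp only [attach, size] at ht'; omega
          · simp only [attach]
            rw [energy_graft, hE0]; linarith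
      · obtain ⟨s', hs', hneg'⟩ := exists_neg_of_sum_neg
          (by linarith : (l₁.map (rootSum a)).sum < 0)
        obtain ⟨l₂, hp₂⟩ := exists_perm_cons_of_mem hs'
        rw [(hp₂.map _).sum_eq, List.map_cons, List.sum_cons] at ho
        have hcount₂ := hp₂.countP_eq (fun s => rootSum a s < 0)
        simp only [List.countP_cons, hneg', decide_true, if_true] at hcount₂
        have hF₂ := rootSum_attach a single l₂
        simp only [rootSum] at hF₂
        have hm := energy_merge_le h0 R (attach single l₂) s s' (by
          refine mul_nonneg_of_nonpos_of_nonpos hsneg.le ?_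
          rw [hF₂]; nlinarith)
        have hsz₂ := size_attach_perm single hp₂
        simp only [attach, size] at hsz₂
        obtain ⟨t', ht', hE''⟩ := ih (graft s' s :: l₂) (by
            rw [List.countP_cons]; split_ifs <;> omega) (by
            intro x hx
            refine hI x ?_
            simp only [attach, size] at hx; omega)
        refine ⟨t', ?_, hE''.trans ?_⟩
        · simp only [attach, size] at ht'; omega
        · have e := energy_attach_perm a R single (hp₂.cons s)
          simp only [attach] at e
          rw [hE0, e]
          simp only [attach]
          rw [energy_graft]; linarith

/-- A branch in a field at least 1 is handled by `exists_leaf_of_one_le`. If there is none, then,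
since `a * φ > 0`, the branches other than any given one have positive total root sum, which
provides two positive branches `p` and `q`. Improving them allows merging them, lowering the number
of branches, or reaching a field at least 1, or producing a leaf directly. -/
theorem exists_leaf (h1 : -1 < a) (h0 : a < 0) {φ : ℝ} (hφ : φ < 0) (N : ℕ) :
    ∀ l : List BranchTree, l.length = N → l ≠ [] →
    (∀ s, size s < size (attach single l) → Improves a s) →
    ∃ t', size t' + 1 = size (attach single l) ∧
      energy a φ (graft t' single) ≤ energy a φ (attach single l) := by
  induction N with
  | zero => intro l hl hne; exact absurd (List.length_eq_zero_iff.1 hl) hne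
  | succ N ih =>
  intro l hlen hl hI
  by_cases hex : ∃ s ∈ l, 1 ≤ 1 + a * ((l.map (rootSum a)).sum - rootSum a s) + a * φ
  · obtain ⟨s, hs, hR⟩ := hex
    obtain ⟨l', hp⟩ := exists_perm_cons_of_mem hs
    rw [(hp.map _).sum_eq, List.map_cons, List.sum_cons, add_sub_cancel_left] at hR
    obtain ⟨ls, rfl⟩ := exists_attach s
    obtain ⟨t', ht', hE⟩ := exists_leaf_of_one_le h1 h0 φ (attach single l')
      (by rw [rootSum_attach]; exact hR) _ ls le_rfl
      (fun x hx => hI x (hx.trans (size_lt_of_mem hs)))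
    rw [energy_attach_perm a φ single hp, size_attach_perm single hp]
    exact ⟨t', ht', hE⟩
  push Not at hex
  have hrest : ∀ s ∈ l, ∃ l' s', l.Perm (s :: s' :: l') ∧ 0 < rootSum a s' := fun s hs => by
    obtain ⟨l₁, hp⟩ := exists_perm_cons_of_mem hs
    have h2 := hex s hs
    rw [(hp.map _).sum_eq, List.map_cons, List.sum_cons, add_sub_cancel_left] at h2
    obtain ⟨s', hs', hpos⟩ := exists_pos_of_sum_pos (l := l₁) (g := rootSum a) (by
      by_contra! hc; nlinarith)
    obtain ⟨l₂, hp₂⟩ := exists_perm_cons_of_mem hs'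
    exact ⟨l₂, s', hp.trans (hp₂.cons _), hpos⟩
  obtain ⟨s₀, hs₀⟩ := List.exists_mem_of_ne_nil l hl
  obtain ⟨_, p, hp₀, hp0⟩ := hrest s₀ hs₀
  have hpl : p ∈ l := hp₀.mem_iff.2 (by simp)
  obtain ⟨l₂, q, hpq, hq0⟩ := hrest p hpl
  have hql : q ∈ l := hpq.mem_iff.2 (by simp)
  have hIp := hI p (size_lt_of_mem hpl)
  have hIq := hI q (size_lt_of_mem hql)
  rw [energy_attach_perm a φ single hpq]
  have hsz := size_attach_perm single hpq
  rw [hsz] at hI ⊢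
  simp only [attach, size] at hI ⊢
  have hlen₂ : l₂.length + 1 = N := by
    have := hpq.length_eq; simp only [List.length_cons] at this; omega
  set t := attach single l₂ with ht
  set r := rootSum a t + a * φ with hr
  -- First exit: `p` and `q` fused into one branch `x`, with fewer branches left for the induction.
  have hred : ∀ x, size x = size p + size q →
      energy a φ (graft t x) ≤ energy a φ (graft (graft t q) p) →
      ∃ t', size t' + 1 = size t + size q + size p ∧
        energy a φ (graft t' single) ≤ energy a φ (graft (graft t q) p) := fun x hx hE => by
    obtain ⟨t', ht', hE'⟩ := ih (x :: l₂) (by simp [hlen₂]) (by simp) (by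
      intro y hy
      refine hI y ?_
      simp only [attach, size, ← ht] at hy; omega)
    simp only [attach, size, ← ht] at ht'
    exact ⟨t', by omega, hE'.trans hE⟩
  -- Second exit: `p` and `q` replaced by `x` and `y` such that the field on `x` is at least 1.
  have hlift : ∀ x y, size x + size y = size p + size q → 1 ≤ rootSum a (graft t y) + a * φ →
      energy a φ (graft (graft t y) x) ≤ energy a φ (graft (graft t q) p) →
      ∃ t', size t' + 1 = size t + size q + size p ∧
        energy a φ (graft t' single) ≤ energy a φ (graft (graft t q) p) :=
    fun x y hxy hR hE => by
      obtain ⟨ls, rfl⟩ := exists_attach x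
      obtain ⟨t', ht', hE'⟩ := exists_leaf_of_one_le h1 h0 φ (graft t y) hR _ ls le_rfl
        (fun z hz => hI z (by have := size_pos t; omega))
      simp only [size] at ht'
      exact ⟨t', by omega, hE'.trans hE⟩
  rcases le_or_gt 1 (rootSum a (graft t q) + a * φ) with hR | hR
  · exact hlift p q rfl hR le_rfl
  have hR' : rootSum a (graft t q) + a * φ = r + a * rootSum a q := by
    rw [hr]; simp only [rootSum]; ring
  obtain ⟨p', hp', hpE, hpc⟩ := hIp _ hR.le
  have hE1 := energy_graft_right_le a φ (graft t q) hpE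
  rcases hpc with ⟨hneg, c, rfl, -⟩ | ⟨i, rfl⟩
  · rw [hR'] at hneg
    rcases le_or_gt r 1 with hr1 | hr1
    · refine hred (graft c (graft single q)) (by simp only [size] at hp' ⊢; omega) ?_
      exact (energy_merge_leaf_le h1 h0 φ t c [q] (by simpa using hq0.le) hr1).trans hE1
    · rcases le_or_gt 0 (rootSum a (graft c single)) with hc | hc
      · refine hred (graft q (graft c single)) (by simp only [size] at hp' ⊢; omega) ?_
        -- From `r + a * rootSum a q < 0`, `r > 1` and `-1 < a < 0` one gets `rootSum a q > r`, so
        -- moving the other branch onto `q` does not raise the energy.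
        refine (energy_merge_le h0 φ t _ q (mul_nonneg hc ?_)).trans hE1
        nlinarith
      · refine hlift q (graft c single) (by omega) ?_ ?_
        · rw [rootSum]; nlinarith
        · rw [energy_graft_comm]; exact hE1
  · have hi := rootSum_path_mem h1 h0 i
    rcases le_or_gt 1 (rootSum a (graft t (path i)) + a * φ) with hR2 | hR2
    · exact hlift q (path i) (by omega) hR2 (by rw [energy_graft_comm]; exact hE1)
    have hR2' : rootSum a (graft t (path i)) + a * φ = r + a * rootSum a (path i) := by
      rw [hr]; simp only [rootSum]; ring
    obtain ⟨q', hq', hqE, hqc⟩ := hIq _ hR2.le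
    have hE2 := energy_graft_right_le a φ (graft t (path i)) hqE
    rw [energy_graft_comm a φ t (path i) q] at hE2
    replace hE2 := hE2.trans hE1
    rcases hqc with ⟨hneg, c, rfl, -⟩ | ⟨j, rfl⟩
    · rw [hR2'] at hneg
      -- The root sum of a path is at most 1, so the negative field `r + a * rootSum a (path i)`
      -- forces `r ≤ 1`.
      refine hred (graft c (graft single (path i))) (by simp only [size] at hq' ⊢; omega) ?_
      exact (energy_merge_leaf_le h1 h0 φ t c [path i] (by simpa using hi.1)
        (by nlinarith)).trans hE2
    · rw [size_path] at hp' hq'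
      rcases le_or_gt r 1 with hr1 | hr1
      · refine hred (path (j + i + 1)) (by rw [size_path]; omega) ?_
        exact (energy_two_paths_le h1 h0 φ t j i hr1).trans hE2
      · refine ⟨graft t (path (j + i)), by simp only [size, size_path]; omega, ?_⟩
        exact (energy_two_paths_leaf_le h1 h0 φ t j i hr1.le).trans hE2

/-- For `φ ≥ 0` the root is left with one branch, in the field `1 + a * φ ≥ 0`; only the path
alternative of the induction hypothesis is possible there. For `φ < 0` a leaf is created below the
root and the remaining tree is improved in turn. -/
theorem improves_of_size (h1 : -1 < a) (h0 : a < 0) (m : ℕ) :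
    ∀ s : BranchTree, size s = m → Improves a s := by
  induction m using Nat.strong_induction_on with
  | _ m ih =>
  intro s hs φ hφ
  obtain ⟨l, rfl⟩ := exists_attach s
  by_cases hl : l = []
  · subst hl
    exact ⟨single, rfl, le_rfl, Or.inr ⟨0, rfl⟩⟩
  have hI : ∀ x, size x < size (attach single l) → Improves a x := fun x hx =>
    ih (size x) (by omega) x rfl
  rcases le_or_gt 0 φ with hφ0 | hφ0
  · obtain ⟨x, hx, hE⟩ := exists_single_branch h1 h0 hφ0 (by nlinarith) _ l le_rfl hl hI
    obtain ⟨x', hx', hE', hc⟩ := hI x (by omega) (rootSum a single + a * φ)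
      (by simp only [rootSum]; nlinarith)
    refine ⟨graft single x', by simp only [size]; omega,
      (energy_graft_right_le a φ single hE').trans hE, Or.inr ?_⟩
    rcases hc with ⟨hneg, -⟩ | ⟨k, rfl⟩
    · simp only [rootSum] at hneg; nlinarith
    · exact ⟨k + 1, rfl⟩
  · obtain ⟨t, ht, hE⟩ := exists_leaf h1 h0 hφ0 _ l rfl hl hI
    -- A leaf at the root acts on `t` as one more unit of outer weight: in the field `φ`, the energy
    -- of `graft t single` is that of `t` in the field `φ + 1`, up to a constant.
    obtain ⟨t', ht', hE', hc⟩ := hI t (by omega) (φ + 1) (by linarith)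
    refine ⟨graft t' single, by simp only [size]; omega, le_trans ?_ hE, Or.inl ⟨hφ0, t', rfl, ?_⟩⟩
    · simp only [energy, pairSum, rootSum] at hE' ⊢
      linarith
    · rcases hc with ⟨-, c, rfl, hc⟩ | ⟨k, rfl⟩
      · simp only [rootSum]; linarith
      · exact (rootSum_path_mem h1 h0 k).2

/-- A path hung by its end has the least energy. -/
theorem energy_path_le (h1 : -1 < a) (h0 : a < 0) {φ : ℝ} (hφ : 0 ≤ φ) (hφ' : -(a * φ) ≤ 1)
    (t : BranchTree) : energy a φ (path (size t - 1)) ≤ energy a φ t := by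
  obtain ⟨l, rfl⟩ := exists_attach t
  by_cases hl : l = []
  · subst hl; exact le_rfl
  obtain ⟨x, hx, hE⟩ := exists_single_branch h1 h0 hφ hφ' _ l le_rfl hl
    fun s _ => improves_of_size h1 h0 _ s rfl
  obtain ⟨x', hx', hE', hc⟩ := improves_of_size h1 h0 _ x rfl (rootSum a single + a * φ)
      (by simp only [rootSum]; nlinarith)
  rcases hc with ⟨hneg, -⟩ | ⟨k, rfl⟩
  · simp only [rootSum] at hneg; nlinarith
  · rw [size_path] at hx'
    rw [show size (attach single l) - 1 = k + 1 by omega]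
    exact (energy_graft_right_le a φ single hE').trans hE

end Negative

/-! ### Minimal pair sums for the other values of `a` -/

theorem rootSum_path_le_of_pos {a : ℝ} (h0 : 0 < a) (h1 : a ≤ 1) (t : BranchTree) :
    rootSum a (path (size t - 1)) ≤ rootSum a t := by
  induction t with
  | single => exact le_rfl
  | graft t s iht ihs =>
    have := size_pos t; have := size_pos s
    rw [show size (graft t s) - 1 = (size t - 1) + (size s - 1) + 1 by simp only [size]; omega,
      rootSum_path_add, rootSum]
    have hpos : ∀ k, 0 ≤ rootSum a (path k) := fun k => by
      induction k with
      | zero => simp [path, rootSum]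
      | succ k ih => simp only [path, rootSum]; positivity
    -- In the path the second piece hangs at distance `size t ≥ 1` from the end; in the graft it
    -- hangs at distance 1 from the root.
    have : a ^ (size t - 1 + 1) ≤ a := by
      rw [pow_succ]; exact mul_le_of_le_one_left h0.le (pow_le_one₀ h0.le h1)
    have := mul_le_mul_of_nonneg_right this (hpos (size s - 1))
    nlinarith

/-- For positive `a` the cross term increases with both root sums, and these are least for paths, so
the two pieces are compared separately. -/
theorem pairSum_path_le_of_pos {a : ℝ} (h0 : 0 < a) (h1 : a ≤ 1) (t : BranchTree) :
    pairSum a (path (size t - 1)) ≤ pairSum a t := by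
  induction t with
  | single => exact le_rfl
  | graft t s iht ihs =>
    have := size_pos t; have := size_pos s
    rw [show size (graft t s) - 1 = (size t - 1) + (size s - 1) + 1 by simp only [size]; omega,
      pairSum_path_add, pairSum]
    have hpos : ∀ k, 0 ≤ rootSum a (path k) := fun k => by
      induction k with
      | zero => simp [path, rootSum]
      | succ k ih => simp only [path, rootSum]; positivity
    have := mul_le_mul (rootSum_path_le_of_pos h0 h1 t) (rootSum_path_le_of_pos h0 h1 s)
      (hpos _) ((hpos _).trans (rootSum_path_le_of_pos h0 h1 t))
    nlinarith

theorem pairSum_zero (t : BranchTree) : pairSum 0 t = size t := by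
  induction t with
  | single => simp [pairSum, size]
  | graft t s iht ihs => simp [pairSum, size, iht, ihs]

theorem rootSum_one (t : BranchTree) : rootSum 1 t = size t := by
  induction t with
  | single => simp [rootSum, size]
  | graft t s iht ihs => simp [rootSum, size, iht, ihs]

theorem pairSum_one (t : BranchTree) : pairSum 1 t = (size t : ℝ) ^ 2 := by
  induction t with
  | single => simp [pairSum, size]
  | graft t s iht ihs => simp [pairSum, size, iht, ihs, rootSum_one]; ring

/-- The parity of `d(u, v)` is that of `d(root, u) + d(root, v)`, so the double sum factors. -/
theorem pairSum_neg_one (t : BranchTree) : pairSum (-1) t = rootSum (-1) t ^ 2 := by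
  induction t with
  | single => simp [pairSum, rootSum]
  | graft t s iht ihs => simp [pairSum, rootSum, iht, ihs]; ring

theorem rootSum_neg_one (t : BranchTree) : ∃ z : ℤ, rootSum (-1) t = size t - 2 * z := by
  induction t with
  | single => exact ⟨0, by simp [rootSum, size]⟩
  | graft t s iht ihs =>
    obtain ⟨x, hx⟩ := iht
    obtain ⟨y, hy⟩ := ihs
    exact ⟨x - y + size s, by simp only [rootSum, size, hx, hy]; push_cast; ring⟩

theorem rootSum_neg_one_path (k : ℕ) : rootSum (-1) (path k) = 0 ∨ rootSum (-1) (path k) = 1 := by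
  induction k with
  | zero => simp [path, rootSum]
  | succ k ih => rcases ih with h | h <;> simp [path, rootSum, h]

theorem pairSum_path_le_neg_one (t : BranchTree) :
    pairSum (-1) (path (size t - 1)) ≤ pairSum (-1) t := by
  rw [pairSum_neg_one, pairSum_neg_one]
  have hs := size_pos t
  obtain ⟨x, hx⟩ := rootSum_neg_one t
  obtain ⟨y, hy⟩ := rootSum_neg_one (path (size t - 1))
  rw [size_path, show size t - 1 + 1 = size t by omega] at hy
  rcases rootSum_neg_one_path (size t - 1) with h | h
  · rw [h]; nlinarith [sq_nonneg (rootSum (-1) t)]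
  -- A path with root sum 1 has odd size, so the root sum of `t`, of the same parity as the size, is
  -- a nonzero integer.
  · have hne : (size t : ℤ) - 2 * x ≠ 0 := by
      have : (size t : ℤ) - 2 * y = 1 := by exact_mod_cast hy.symm.trans h
      omega
    rw [h, hx]
    have : 1 ≤ ((size t : ℤ) - 2 * x) ^ 2 := by
      have := Int.one_le_abs hne
      rw [← sq_abs]; nlinarith
    rw [one_pow]; exact_mod_cast this

/-- Among the trees of a given size, the path has the least pair sum. -/
theorem pairSum_path_le {a : ℝ} (h1 : -1 ≤ a) (h1' : a ≤ 1) (t : BranchTree) :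
    pairSum a (path (size t - 1)) ≤ pairSum a t := by
  rcases h1.eq_or_lt with rfl | h1
  · exact pairSum_path_le_neg_one t
  rcases lt_trichotomy a 0 with h0 | rfl | h0
  · have := energy_path_le h1 h0 le_rfl (by simp) t
    simpa [energy] using this
  · rw [pairSum_zero, pairSum_zero, size_path]
    have := size_pos t
    rw [Nat.sub_add_cancel this]
  · exact pairSum_path_le_of_pos h0 h1' t

/-- If a tree with a leaf `v` has the pair sum of a path, then so does the tree without `v`, and
the neighbor of `v` has the root sum of an end of a path. -/
theorem eq_path_of_pairSum_graft_single {a : ℝ} (h1 : -1 < a) (h1' : a < 1) (h0 : a ≠ 0)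
    {t : BranchTree} (h : pairSum a (graft t single) = pairSum a (path (size t))) :
    pairSum a t = pairSum a (path (size t - 1)) ∧
      rootSum a t = rootSum a (path (size t - 1)) := by
  have hp : pairSum a (path (size t)) = 1 + pairSum a (path (size t - 1))
      + 2 * a * rootSum a (path (size t - 1)) := by
    conv_lhs => rw [← Nat.sub_add_cancel (size_pos t)]
    simp only [path, pairSum, rootSum]; ring
  rw [hp] at h
  simp only [pairSum, rootSum] at h
  rcases h0.lt_or_gt with h0 | h0
  · have e0 := energy_path_le h1 h0 le_rfl (by simp) t
    -- This is the largest admissible field; there `2 * a * φ = -2`. With `D` and `E` the excesses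
    -- of the pair sum and root sum of `t` over those of the path, `D ≥ 0`, `D ≥ 2 * E`, and the
    -- hypothesis says `D = -2 * a * E`. Since `-1 < a < 0`, both vanish.
    have e1 := energy_path_le h1 h0 (φ := -1 / a) (div_nonneg_of_nonpos (by norm_num) h0.le)
      (by field_simp; norm_num) t
    simp only [energy] at e0 e1
    have ha : 2 * a * (-1 / a) = -2 := by field_simp
    rw [ha] at e1
    have : pairSum a t = pairSum a (path (size t - 1)) := by
      refine le_antisymm ?_ (by linarith)
      nlinarith
    refine ⟨this, ?_⟩
    nlinarith
  · have e0 := pairSum_path_le_of_pos h0 h1'.le t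
    have e1 := rootSum_path_le_of_pos h0 h1'.le t
    constructor <;> nlinarith

end BranchTree

/-! ### Distances in the Ulam-Harris-Neveu tree -/

namespace UHN

/-- The distance of two words in the tree. -/
def wdist : UHN → UHN → ℕ
  | [], v => v.length
  | _ :: u, [] => u.length + 1
  | i :: u, j :: v => if i = j then wdist u v else u.length + v.length + 2

theorem wdist_comm (u v : UHN) : wdist u v = wdist v u := by
  induction u generalizing v with
  | nil => cases v <;> simp [wdist]
  | cons i u ih =>
    cases v with
    | nil => simp [wdist]
    | cons j v =>
      simp only [wdist, ih v, eq_comm (a := i), add_comm u.length]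

@[simp] theorem wdist_self (u : UHN) : wdist u u = 0 := by
  induction u with
  | nil => rfl
  | cons i u ih => simp [wdist, ih]

theorem eq_of_wdist_eq_zero (u v : UHN) (h : wdist u v = 0) : u = v := by
  induction u generalizing v with
  | nil => simpa [wdist, eq_comm] using h
  | cons i u ih =>
    cases v with
    | nil => simp [wdist] at h
    | cons j v =>
      simp only [wdist] at h
      split_ifs at h with hij
      rw [hij, ih v h]

theorem wdist_nil_left (v : UHN) : wdist [] v = v.length := by cases v <;> rfl

theorem wdist_of_prefix (c v : UHN) (h : c <+: v) : wdist c v = v.length - c.length := by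
  induction c generalizing v with
  | nil => simp [wdist_nil_left]
  | cons i c ih =>
    cases v with
    | nil => simp at h
    | cons j v =>
      rw [List.cons_prefix_cons] at h
      simp [wdist, h.1, ih v h.2]

/-- The edge from `c` to its parent separates the words below `c` from the other ones. -/
theorem wdist_eq_of_not_prefix {c u v : UHN} (hv : c <+: v) (hu : ¬ c <+: u) :
    wdist u v = wdist u (parent c) + 1 + wdist c v := by
  induction c generalizing u v with
  | nil => simp at hu
  | cons i c ih =>
    cases v with
    | nil => simp at hv
    | cons j v =>
      rw [List.cons_prefix_cons] at hv
      obtain ⟨rfl, hv⟩ := hv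
      have hlen := hv.length_le
      rcases eq_or_ne c [] with rfl | hc
      · rw [wdist_of_prefix [i] (i :: v) (by simp)]
        cases u with
        | nil => simp [wdist, parent]; omega
        | cons k u =>
          rw [List.cons_prefix_cons] at hu
          have hki : k ≠ i := fun h => hu ⟨h.symm, List.nil_prefix⟩
          simp [wdist, parent, hki]; omega
      · have hp : parent (i :: c) = i :: parent c := by
          simp [parent, List.dropLast_cons_of_ne_nil hc]
        rw [hp]
        have hcpos := List.length_pos_iff.2 hc
        cases u with
        | nil =>
          simp only [wdist, if_true, wdist_of_prefix c v hv, parent, List.length_cons,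
            List.length_dropLast]
          omega
        | cons k u =>
          rw [List.cons_prefix_cons, not_and'] at hu
          by_cases hki : k = i
          · subst hki
            have : ¬ c <+: u := fun h => hu h rfl
            simp only [wdist, if_true]
            exact ih hv this
          · simp only [wdist, if_true, if_neg hki, wdist_of_prefix c v hv, parent,
              List.length_dropLast]
            omega

theorem parent_prefix (u : UHN) : parent u <+: u := List.dropLast_prefix u

theorem length_parent_lt {u : UHN} (h : u ≠ []) : (parent u).length < u.length := by
  have := List.length_pos_iff.2 h
  rw [parent, List.length_dropLast]; omega

theorem prefix_parent_of_prefix {c u : UHN} (h : c <+: u) (hne : c ≠ u) : c <+: parent u := by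
  obtain ⟨w, rfl⟩ := h
  have hw : w ≠ [] := by rintro rfl; simp at hne
  rw [parent, List.dropLast_append_of_ne_nil hw]
  exact List.prefix_append _ _

theorem wdist_parent {u : UHN} (h : u ≠ []) : wdist (parent u) u = 1 := by
  have hn : ¬ u <+: parent u := fun hp => by
    have := hp.length_le
    have := length_parent_lt h
    omega
  rw [wdist_eq_of_not_prefix (List.prefix_refl u) hn]; simp

theorem graph_adj_iff {u v : UHN} :
    graph.Adj u v ↔ (u ≠ [] ∧ parent u = v) ∨ (v ≠ [] ∧ parent v = u) := by
  rw [graph, SimpleGraph.fromRel_adj]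
  refine ⟨fun h => h.2, fun h => ⟨?_, h⟩⟩
  rintro rfl
  rcases h with ⟨h1, h2⟩ | ⟨h1, h2⟩ <;>
  · have := length_parent_lt h1
    rw [h2] at this
    exact lt_irrefl _ this

theorem graph_adj_iff_wdist {u v : UHN} : graph.Adj u v ↔ wdist u v = 1 := by
  rw [graph_adj_iff]
  constructor
  · rintro (⟨h, rfl⟩ | ⟨h, rfl⟩)
    · rw [wdist_comm]; exact wdist_parent h
    · exact wdist_parent h
  · intro h
    have hne : u ≠ v := by rintro rfl; simp at h
    by_cases hvu : v <+: u
    · have huv : ¬ u <+: v := fun huv => hne (huv.eq_of_length_le hvu.length_le)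
      have := wdist_eq_of_not_prefix (List.prefix_refl u) huv
      rw [wdist_comm v u, h, wdist_self] at this
      refine Or.inl ⟨?_, (eq_of_wdist_eq_zero _ _ (by omega)).symm⟩
      rintro rfl; exact huv List.nil_prefix
    · have := wdist_eq_of_not_prefix (List.prefix_refl v) hvu
      rw [h, wdist_self] at this
      refine Or.inr ⟨?_, (eq_of_wdist_eq_zero _ _ (by omega)).symm⟩
      rintro rfl; exact hvu List.nil_prefix

/-! ### Subtrees -/

/-- `A` is a subtree with top vertex `r`. -/
def IsSubtreeAt (r : UHN) (A : Finset UHN) : Prop :=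
  r ∈ A ∧ ∀ u ∈ A, u ≠ r → u ≠ [] ∧ parent u ∈ A

theorem IsSubtreeAt.prefix_of_mem {r : UHN} {A : Finset UHN} (h : IsSubtreeAt r A) {u : UHN}
    (hu : u ∈ A) : r <+: u := by
  induction hn : u.length using Nat.strong_induction_on generalizing u with
  | _ n ih =>
  by_cases hur : u = r
  · rw [hur]
  obtain ⟨h1, h2⟩ := h.2 u hu hur
  exact (ih _ (hn ▸ length_parent_lt h1) h2 rfl).trans (parent_prefix u)

theorem IsSubtreeAt.mem_of_prefix {r : UHN} {A : Finset UHN} (h : IsSubtreeAt r A) {u w : UHN}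
    (hu : u ∈ A) (hrw : r <+: w) (hwu : w <+: u) : w ∈ A := by
  induction hn : u.length using Nat.strong_induction_on generalizing u with
  | _ n ih =>
  by_cases hwu' : w = u
  · rwa [hwu']
  have hur : u ≠ r := by
    rintro rfl
    exact hwu' (hwu.eq_of_length_le hrw.length_le)
  obtain ⟨h1, h2⟩ := h.2 u hu hur
  exact ih _ (hn ▸ length_parent_lt h1) h2 (prefix_parent_of_prefix hwu hwu') rfl

theorem IsSubtreeAt.filter_prefix {r c : UHN} {A : Finset UHN} (h : IsSubtreeAt r A)
    (hc : c ∈ A) (hcr : c ≠ r) : IsSubtreeAt c (A.filter fun u => c <+: u) := by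
  refine ⟨Finset.mem_filter.2 ⟨hc, List.prefix_refl c⟩, fun u hu huc => ?_⟩
  obtain ⟨huA, hcu⟩ := Finset.mem_filter.1 hu
  have hur : u ≠ r := by
    rintro rfl
    exact hcr (hcu.eq_of_length_le (h.prefix_of_mem hc).length_le)
  obtain ⟨h1, h2⟩ := h.2 u huA hur
  exact ⟨h1, Finset.mem_filter.2 ⟨h2, prefix_parent_of_prefix hcu huc.symm⟩⟩

theorem IsSubtreeAt.filter_not_prefix {r c : UHN} {A : Finset UHN} (h : IsSubtreeAt r A)
    (hc : c ∈ A) (hcr : c ≠ r) : IsSubtreeAt r (A.filter fun u => ¬ c <+: u) := by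
  refine ⟨Finset.mem_filter.2 ⟨h.1, fun hcr' => hcr
    (hcr'.eq_of_length_le (h.prefix_of_mem hc).length_le)⟩, fun u hu hur => ?_⟩
  obtain ⟨huA, hcu⟩ := Finset.mem_filter.1 hu
  obtain ⟨h1, h2⟩ := h.2 u huA hur
  exact ⟨h1, Finset.mem_filter.2 ⟨h2, fun hp => hcu (hp.trans (parent_prefix u))⟩⟩

theorem IsSubtreeAt.isSubtree {r : UHN} {A : Finset UHN} (h : IsSubtreeAt r A) :
    IsSubtree A := by
  have hreach : ∀ n : ℕ, ∀ u (hu : u ∈ A), u.length = n →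
      (graph.induce (A : Set UHN)).Reachable ⟨r, h.1⟩ ⟨u, hu⟩ := by
    intro n
    induction n using Nat.strong_induction_on with
    | _ n ih =>
    intro u hu hn
    by_cases hur : u = r
    · subst hur; rfl
    obtain ⟨h1, h2⟩ := h.2 u hu hur
    refine (ih _ (hn ▸ length_parent_lt h1) _ h2 rfl).trans (SimpleGraph.Adj.reachable ?_)
    rw [SimpleGraph.induce_adj]
    exact graph_adj_iff.2 (Or.inr ⟨h1, rfl⟩)
  have : Nonempty (A : Set UHN) := ⟨⟨r, h.1⟩⟩
  exact ⟨fun u v => (hreach _ u u.2 rfl).symm.trans (hreach _ v v.2 rfl)⟩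

/-- The top is a vertex of least length. Along any walk in `A` from it, all words between the top
and the current vertex stay in `A`: a step up cannot pass the top, and a step down adds just one
word. -/
theorem IsSubtree.exists_isSubtreeAt {A : Finset UHN} (h : IsSubtree A) :
    ∃ r, IsSubtreeAt r A := by
  have hpre := h.preconnected
  obtain ⟨x₀⟩ := h.nonempty
  obtain ⟨r, hr, hmin⟩ := A.exists_min_image List.length ⟨x₀, x₀.2⟩
  refine ⟨r, hr, ?_⟩
  have inv : ∀ u : (A : Set UHN), r <+: u.1 ∧ ∀ w, r <+: w → w <+: u.1 → w ∈ A := by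
    intro u
    have hreach := hpre ⟨r, hr⟩ u
    rw [SimpleGraph.reachable_iff_reflTransGen] at hreach
    induction hreach with
    | refl =>
      refine ⟨List.prefix_refl r, fun w h1 h2 => ?_⟩
      rwa [h2.eq_of_length_le h1.length_le]
    | @tail u w _ hadj ih =>
      rw [SimpleGraph.induce_adj] at hadj
      rcases graph_adj_iff.1 hadj with ⟨h1, h2⟩ | ⟨h1, h2⟩
      · have hur : r ≠ u.1 := fun hur => by
          have := hmin w.1 w.2
          have := length_parent_lt h1
          rw [h2, ← hur] at this
          omega
        refine ⟨?_, fun x hx hxw => ih.2 x hx (hxw.trans ?_)⟩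
        · rw [← h2]; exact prefix_parent_of_prefix ih.1 hur
        · rw [← h2]; exact parent_prefix _
      · refine ⟨ih.1.trans (h2 ▸ parent_prefix _), fun x hx hxw => ?_⟩
        by_cases hxe : x = w.1
        · rw [hxe]; exact w.2
        · exact ih.2 x hx (h2 ▸ prefix_parent_of_prefix hxw hxe)
  intro u hu hur
  obtain ⟨h1, h2⟩ := inv ⟨u, hu⟩
  refine ⟨?_, h2 _ (prefix_parent_of_prefix h1 (Ne.symm hur)) (parent_prefix u)⟩
  rintro rfl
  exact hur (List.prefix_nil.1 h1).symm

/-- Adding to a subtree a vertex adjacent to it. -/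
theorem IsSubtreeAt.insert_adj {r x v : UHN} {A : Finset UHN} (h : IsSubtreeAt r A) (hx : x ∈ A)
    (hv : v ∉ A) (hadj : graph.Adj x v) :
    (∃ r', IsSubtreeAt r' (insert v A)) ∧ ∀ u ∈ A, wdist v u = wdist x u + 1 := by
  rcases graph_adj_iff.1 hadj with ⟨h1, h2⟩ | ⟨h1, h2⟩
  -- Here `v` is the parent of `x`; since `v ∉ A`, the vertex `x` is the top of `A`, and `v` becomes
  -- the new top.
  · have hxr : x = r := by
      by_contra hxr
      exact hv (h2 ▸ (h.2 x hx hxr).2)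
    subst hxr
    refine ⟨⟨v, Finset.mem_insert_self _ _, fun u hu huv => ?_⟩, fun u hu => ?_⟩
    · have huA := (Finset.mem_insert.1 hu).resolve_left huv
      by_cases hux : u = x
      · subst hux; exact ⟨h1, by rw [h2]; exact Finset.mem_insert_self _ _⟩
      · obtain ⟨h3, h4⟩ := h.2 u huA hux
        exact ⟨h3, Finset.mem_insert_of_mem h4⟩
    · have hn : ¬ x <+: v := fun hp => by
        have := hp.length_le
        have := length_parent_lt h1
        rw [h2] at this; omega
      rw [wdist_eq_of_not_prefix (h.prefix_of_mem hu) hn, h2, wdist_self]; omega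
  · refine ⟨⟨r, Finset.mem_insert_of_mem h.1, fun u hu hur => ?_⟩, fun u hu => ?_⟩
    · rcases Finset.mem_insert.1 hu with rfl | hu
      · exact ⟨h1, by rw [h2]; exact Finset.mem_insert_of_mem hx⟩
      · obtain ⟨h3, h4⟩ := h.2 u hu hur
        exact ⟨h3, Finset.mem_insert_of_mem h4⟩
    · have hn : ¬ v <+: u := fun hp => by
        refine hv (h.mem_of_prefix hu ?_ hp)
        rw [← h2] at hx
        exact (h.prefix_of_mem hx).trans (parent_prefix v)
      rw [wdist_comm, wdist_eq_of_not_prefix (List.prefix_refl v) hn, h2, wdist_self, wdist_comm]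

/-! ### Distance sums of subtrees -/

open BranchTree

/-- `∑ a ^ d(u, v)` over the pairs of vertices of `A`. -/
noncomputable def distSum (a : ℝ) (A : Finset UHN) : ℝ := ∑ u ∈ A, ∑ v ∈ A, a ^ wdist u v

/-- `∑ a ^ d(x, u)` over the vertices of `A`. -/
noncomputable def distSumFrom (a : ℝ) (x : UHN) (A : Finset UHN) : ℝ := ∑ u ∈ A, a ^ wdist x u

/-- The rooted tree `t` has the size and the distance sums of `A`, seen from `x`. -/
def Represents (t : BranchTree) (x : UHN) (A : Finset UHN) : Prop :=
  size t = A.card ∧ ∀ a : ℝ, rootSum a t = distSumFrom a x A ∧ pairSum a t = distSum a A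

theorem Represents.graft {t s : BranchTree} {x y : UHN} {A B : Finset UHN}
    (ht : Represents t x A) (hs : Represents s y B) (hx : x ∈ A) (hAB : Disjoint A B)
    (hd : ∀ u ∈ A, ∀ v ∈ B, wdist u v = wdist u x + 1 + wdist y v) :
    Represents (graft t s) x (A ∪ B) := by
  refine ⟨by rw [Finset.card_union_of_disjoint hAB, size, ht.1, hs.1], fun a => ⟨?_, ?_⟩⟩
  · rw [rootSum, (ht.2 a).1, (hs.2 a).1, distSumFrom, distSumFrom, distSumFrom,
      Finset.sum_union hAB, Finset.mul_sum]
    congr 1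
    refine Finset.sum_congr rfl fun v hv => ?_
    rw [hd x hx v hv, wdist_self]; ring
  · have hcross : ∑ u ∈ A, ∑ v ∈ B, a ^ wdist u v
        = a * distSumFrom a x A * distSumFrom a y B := by
      rw [mul_assoc, distSumFrom, distSumFrom, Finset.sum_mul_sum, Finset.mul_sum]
      refine Finset.sum_congr rfl fun u hu => ?_
      rw [Finset.mul_sum]
      refine Finset.sum_congr rfl fun v hv => ?_
      rw [hd u hu v hv, wdist_comm u x]; ring
    have hcross' : ∑ u ∈ B, ∑ v ∈ A, a ^ wdist u v
        = a * distSumFrom a x A * distSumFrom a y B := by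
      rw [← hcross, Finset.sum_comm]
      exact Finset.sum_congr rfl fun u _ => Finset.sum_congr rfl fun v _ => by rw [wdist_comm]
    rw [pairSum, (ht.2 a).1, (hs.2 a).1, (ht.2 a).2, (hs.2 a).2]
    simp only [distSum, Finset.sum_union hAB, Finset.sum_add_distrib]
    rw [hcross, hcross']; ring

theorem represents_single (x : UHN) : Represents single x {x} :=
  ⟨rfl, fun a => by simp [rootSum, pairSum, distSumFrom, distSum]⟩

/-- Cut an edge at `x`, towards a child if `x` is the top and towards the parent otherwise, and
apply induction to both sides. The freedom in `x` is needed to root a tree at the neighbor of a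
leaf. -/
theorem IsSubtreeAt.exists_represents {r : UHN} {A : Finset UHN} (h : IsSubtreeAt r A) {x : UHN}
    (hx : x ∈ A) : ∃ t, Represents t x A := by
  induction hn : A.card using Nat.strong_induction_on generalizing A r x with
  | _ n ih =>
  have split : ∀ c ∈ A, c ≠ r → ∀ y z, (c <+: y ∧ y ∈ A) → (¬ c <+: z ∧ z ∈ A) →
      (∃ t, Represents t y (A.filter fun u => c <+: u)) ∧
      ∃ t, Represents t z (A.filter fun u => ¬ c <+: u) := by
    intro c hc hcr y z hy hz
    have hy' : y ∈ A.filter fun u => c <+: u := Finset.mem_filter.2 hy.symm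
    have hz' : z ∈ A.filter fun u => ¬ c <+: u := Finset.mem_filter.2 hz.symm
    refine ⟨ih _ ?_ (h.filter_prefix hc hcr) hy' rfl,
      ih _ ?_ (h.filter_not_prefix hc hcr) hz' rfl⟩
    · rw [← hn]
      exact Finset.card_lt_card (Finset.filter_ssubset.2 ⟨z, hz.2, hz.1⟩)
    · rw [← hn]
      exact Finset.card_lt_card (Finset.filter_ssubset.2 ⟨y, hy.2, fun hh => hh hy.1⟩)
  have hdisj : ∀ c : UHN, Disjoint (A.filter fun u => ¬ c <+: u) (A.filter fun u => c <+: u) :=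
    fun c => (Finset.disjoint_filter_filter_not A A fun u => c <+: u).symm
  have hunion : ∀ c : UHN, (A.filter fun u => ¬ c <+: u) ∪ (A.filter fun u => c <+: u) = A :=
    fun c => by rw [Finset.union_comm]; exact Finset.filter_union_filter_not_eq _ A
  have hnp : ∀ c : UHN, c ≠ [] → ¬ c <+: parent c := fun c hc hp => by
    have := hp.length_le
    have := length_parent_lt hc
    omega
  by_cases hxr : x = r
  · subst hxr
    by_cases hA : A = {x}
    · exact ⟨single, hA ▸ represents_single x⟩
    obtain ⟨y, hy, hyx⟩ : ∃ y ∈ A, y ≠ x := by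
      by_contra! hc
      exact hA (Finset.eq_singleton_iff_unique_mem.2 ⟨hx, hc⟩)
    -- A shortest vertex other than the top is a child of the top.
    obtain ⟨c, hc, hmin⟩ := (A.erase x).exists_min_image List.length
      ⟨y, Finset.mem_erase.2 ⟨hyx, hy⟩⟩
    obtain ⟨hcx, hcA⟩ := Finset.mem_erase.1 hc
    obtain ⟨hc1, hc2⟩ := h.2 c hcA hcx
    have hpc : parent c = x := by
      by_contra hne
      have := hmin _ (Finset.mem_erase.2 ⟨hne, hc2⟩)
      have := length_parent_lt hc1
      omega
    have hcx' : ¬ c <+: x := hpc ▸ hnp c hc1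
    obtain ⟨⟨s, hs⟩, t, ht⟩ := split c hcA hcx c x ⟨List.prefix_refl c, hcA⟩ ⟨hcx', hx⟩
    refine ⟨BranchTree.graft t s, ?_⟩
    have := ht.graft hs (Finset.mem_filter.2 ⟨hx, hcx'⟩) (hdisj c) (fun u hu v hv => by
      rw [wdist_eq_of_not_prefix (Finset.mem_filter.1 hv).2 (Finset.mem_filter.1 hu).2, hpc])
    rwa [hunion] at this
  · obtain ⟨hx1, hx2⟩ := h.2 x hx hxr
    obtain ⟨⟨s, hs⟩, t, ht⟩ := split x hx hxr x (parent x) ⟨List.prefix_refl x, hx⟩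
      ⟨hnp x hx1, hx2⟩
    refine ⟨BranchTree.graft s t, ?_⟩
    have := hs.graft ht (Finset.mem_filter.2 ⟨hx, List.prefix_refl x⟩) (hdisj x).symm
      (fun u hu v hv => by
        rw [wdist_comm, wdist_eq_of_not_prefix (Finset.mem_filter.1 hu).2
          (Finset.mem_filter.1 hv).2, wdist_comm x u, wdist_comm v]; ring)
    rwa [Finset.union_comm, hunion] at this

/-! ### Lines -/

/-- The words `x 0, …, x (n - 1)` follow each other on a geodesic. -/
def IsGeodesic (n : ℕ) (x : ℕ → UHN) : Prop :=
  ∀ i < n, ∀ j < n, wdist (x i) (x j) = (i - j) + (j - i)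

theorem IsGeodesic.injOn {n : ℕ} {x : ℕ → UHN} (h : IsGeodesic n x) :
    Set.InjOn x (Finset.range n : Set ℕ) := by
  intro i hi j hj hij
  have := h i (by simpa using hi) j (by simpa using hj)
  rw [hij, wdist_self] at this
  omega

theorem rootSum_path_eq_sum (a : ℝ) (k : ℕ) :
    rootSum a (path k) = ∑ i ∈ Finset.range (k + 1), a ^ i := by
  induction k with
  | zero => simp [path, rootSum]
  | succ k ih =>
    rw [path, rootSum, ih, Finset.sum_range_succ' _ (k + 1), rootSum, Finset.mul_sum, add_comm]
    simp [pow_succ, mul_comm]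

/-- With truncated subtraction the exponent is `|i - j|`. The vertex `i` sees a path towards each
end and belongs to both, hence the correction by 1. -/
theorem sum_pow_dist (a : ℝ) (n i : ℕ) (hi : i < n) :
    ∑ j ∈ Finset.range n, a ^ ((i - j) + (j - i))
      = rootSum a (path i) + rootSum a (path (n - 1 - i)) - 1 := by
  have h1 : n = (i + 1) + (n - 1 - i) := by omega
  have h2 : ∑ j ∈ Finset.range (i + 1), a ^ ((i - j) + (j - i)) = rootSum a (path i) := by
    rw [rootSum_path_eq_sum, ← Finset.sum_range_reflect]
    refine Finset.sum_congr rfl fun j hj => ?_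
    rw [Finset.mem_range] at hj
    congr 1; omega
  conv_lhs => rw [h1]
  rw [Finset.sum_range_add, h2, rootSum_path_eq_sum a (n - 1 - i), Finset.sum_range_succ']
  simp only [pow_zero, add_sub_cancel_right, add_sub_assoc]
  congr 1
  refine Finset.sum_congr rfl fun j _ => ?_
  congr 1; omega

theorem sum_sum_pow_dist (a : ℝ) (n : ℕ) :
    ∑ i ∈ Finset.range (n + 1), ∑ j ∈ Finset.range (n + 1), a ^ ((i - j) + (j - i))
      = pairSum a (path n) := by
  induction n with
  | zero => simp [path, pairSum]
  | succ n ih =>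
    have h1 := sum_pow_dist a (n + 2) (n + 1) (by omega)
    rw [Finset.sum_range_succ] at h1
    have h2 : ∑ i ∈ Finset.range (n + 1), a ^ ((i - (n + 1)) + (n + 1 - i))
        = ∑ i ∈ Finset.range (n + 1), a ^ ((n + 1 - i) + (i - (n + 1))) :=
      Finset.sum_congr rfl fun i _ => by rw [add_comm]
    have hs : ∀ g : ℕ → ℝ, ∑ i ∈ Finset.range (n + 1 + 1), g i
        = ∑ i ∈ Finset.range (n + 1), g i + g (n + 1) := fun g => Finset.sum_range_succ g (n + 1)
    simp only [hs, Finset.sum_add_distrib]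
    rw [ih, h2]
    simp only [show n + 2 - 1 - (n + 1) = 0 by omega] at h1
    simp only [path, rootSum, pairSum, Nat.sub_self, add_zero, pow_zero] at h1 ⊢
    linarith

theorem IsGeodesic.distSum_eq {n : ℕ} {x : ℕ → UHN} (h : IsGeodesic (n + 1) x) (a : ℝ) :
    distSum a ((Finset.range (n + 1)).image x) = pairSum a (path n) := by
  rw [distSum, Finset.sum_image h.injOn, ← sum_sum_pow_dist]
  refine Finset.sum_congr rfl fun i hi => ?_
  rw [Finset.sum_image h.injOn]
  refine Finset.sum_congr rfl fun j hj => ?_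
  rw [h i (Finset.mem_range.1 hi) j (Finset.mem_range.1 hj)]

theorem IsGeodesic.distSumFrom_eq {n : ℕ} {x : ℕ → UHN} (h : IsGeodesic n x) (a : ℝ) {i : ℕ}
    (hi : i < n) : distSumFrom a (x i) ((Finset.range n).image x)
      = rootSum a (path i) + rootSum a (path (n - 1 - i)) - 1 := by
  rw [distSumFrom, Finset.sum_image h.injOn, ← sum_pow_dist a n i hi]
  refine Finset.sum_congr rfl fun j hj => ?_
  rw [h i hi j (Finset.mem_range.1 hj)]

theorem IsGeodesic.isLine {n : ℕ} {x : ℕ → UHN} (h : IsGeodesic n x) :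
    IsLine ((Finset.range n).image x) := by
  have hcard : ((Finset.range n).image x).card = n := by
    rw [Finset.card_image_of_injOn h.injOn, Finset.card_range]
  rw [IsLine, hcard]
  let g : Fin n → (((Finset.range n).image x : Finset UHN) : Set UHN) := fun i =>
    ⟨x i, by simpa using ⟨i.1, i.2, rfl⟩⟩
  have hg : Function.Bijective g := by
    constructor
    · intro i j hij
      exact Fin.ext (h.injOn (by simp) (by simp) (congrArg Subtype.val hij))
    · rintro ⟨u, hu⟩
      obtain ⟨i, hi, rfl⟩ := Finset.mem_image.1 (Finset.mem_coe.1 hu)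
      exact ⟨⟨i, Finset.mem_range.1 hi⟩, rfl⟩
  refine ⟨SimpleGraph.Iso.symm ⟨Equiv.ofBijective g hg, ?_⟩⟩
  intro i j
  rw [SimpleGraph.induce_adj, SimpleGraph.pathGraph_adj]
  change graph.Adj (x i) (x j) ↔ _
  rw [graph_adj_iff_wdist, h i i.2 j j.2]
  omega

/-- The isomorphism only makes consecutive vertices adjacent. Adding them one at a time, each
outside the previous ones, `insert_adj` shows that the new vertex is one step further than its
predecessor from all earlier ones. -/
theorem IsLine.exists_isGeodesic {A : Finset UHN} (h : IsLine A) :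
    ∃ x, IsGeodesic A.card x ∧ A = (Finset.range A.card).image x := by
  obtain ⟨e⟩ := h
  set n := A.card with hn
  let x : ℕ → UHN := fun i => if hi : i < n then (e.symm ⟨i, hi⟩).1 else []
  have hx : ∀ i (hi : i < n), x i = (e.symm ⟨i, hi⟩).1 := fun i hi => dif_pos hi
  have hinj : ∀ i < n, ∀ j < n, x i = x j → i = j := fun i hi j hj hij => by
    rw [hx i hi, hx j hj] at hij
    simpa using e.symm.injective (Subtype.ext hij)
  have hadj : ∀ i, i + 1 < n → graph.Adj (x i) (x (i + 1)) := fun i hi => by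
    rw [hx i (by omega), hx (i + 1) hi, ← SimpleGraph.induce_adj (s := (A : Set UHN)),
      SimpleGraph.Iso.map_adj_iff, SimpleGraph.pathGraph_adj]
    exact Or.inl rfl
  have key : ∀ k, k + 1 ≤ n → (∃ r, IsSubtreeAt r ((Finset.range (k + 1)).image x)) ∧
      IsGeodesic (k + 1) x := by
    intro k
    induction k with
    | zero =>
      intro _
      refine ⟨⟨x 0, by simp [IsSubtreeAt]⟩, fun i hi j hj => ?_⟩
      obtain rfl : i = 0 := by omega
      obtain rfl : j = 0 := by omega
      simp
    | succ k ih =>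
      intro hk
      obtain ⟨⟨r, hr⟩, hgeo⟩ := ih (by omega)
      have hmem : ∀ i < k + 1, x i ∈ (Finset.range (k + 1)).image x := fun i hi =>
        Finset.mem_image_of_mem x (Finset.mem_range.2 hi)
      have hnot : x (k + 1) ∉ (Finset.range (k + 1)).image x := fun hc => by
        obtain ⟨i, hi, hix⟩ := Finset.mem_image.1 hc
        rw [Finset.mem_range] at hi
        have := hinj i (by omega) (k + 1) (by omega) hix
        omega
      obtain ⟨hr', hd⟩ := hr.insert_adj (hmem k (by omega)) hnot (hadj k (by omega))
      refine ⟨by rwa [Finset.range_add_one (n := k + 1), Finset.image_insert], fun i hi j hj => ?_⟩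
      rcases Nat.lt_succ_iff_lt_or_eq.1 hi with hi' | rfl <;>
        rcases Nat.lt_succ_iff_lt_or_eq.1 hj with hj' | rfl
      · exact hgeo i hi' j hj'
      · rw [wdist_comm, hd _ (hmem i hi'), hgeo k (by omega) i hi']; omega
      · rw [hd _ (hmem j hj'), hgeo k (by omega) j hj']; omega
      · simp
  refine ⟨x, ?_, ?_⟩
  · rcases Nat.eq_zero_or_pos n with h0 | h0
    · intro i hi; omega
    · have := (key (n - 1) (by omega)).2
      rwa [Nat.sub_add_cancel h0] at this
  · ext u
    rw [Finset.mem_image]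
    constructor
    · intro hu
      refine ⟨e ⟨u, hu⟩, Finset.mem_range.2 (e ⟨u, hu⟩).2, ?_⟩
      rw [hx _ (e ⟨u, hu⟩).2]
      simp
    · rintro ⟨i, hi, rfl⟩
      rw [hx i (Finset.mem_range.1 hi)]
      exact (e.symm _).2

theorem IsLine.distSum_eq {A : Finset UHN} (h : IsLine A) (hA : A.Nonempty) (a : ℝ) :
    distSum a A = pairSum a (path (A.card - 1)) := by
  obtain ⟨x, hx, hAx⟩ := h.exists_isGeodesic
  have hpos := hA.card_pos
  rw [← Nat.sub_add_cancel hpos] at hx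
  rw [← hx.distSum_eq a, Nat.sub_add_cancel hpos, ← hAx]

/-! ### Lines as the only minimizers of the distance sum -/

theorem pairSum_path_le_distSum {A : Finset UHN} (h : IsSubtree A) {a : ℝ} (h1 : -1 ≤ a)
    (h1' : a ≤ 1) : pairSum a (path (A.card - 1)) ≤ distSum a A := by
  obtain ⟨r, hr⟩ := h.exists_isSubtreeAt
  obtain ⟨t, ht, hts⟩ := hr.exists_represents hr.1
  rw [← (hts a).2, ← ht]
  exact pairSum_path_le h1 h1' t

/-- The left side of `h` is the root sum of a path with `i + j + 1` vertices seen from vertex `i`,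
the right side is the one seen from an end. For `i, j ≥ 1` they differ by `(1 - a ^ i) * a * rootSum
a (path (j - 1))`, which is nonzero. So an end is recognized by its root sum. -/
theorem eq_zero_of_rootSum_path_add_eq {a : ℝ} (h1 : -1 < a) (h1' : a < 1) (h0 : a ≠ 0) (i j : ℕ)
    (h : rootSum a (path i) + rootSum a (path j) - 1 = rootSum a (path (i + j))) :
    i = 0 ∨ j = 0 := by
  by_contra! hc
  obtain ⟨i, rfl⟩ := Nat.exists_eq_succ_of_ne_zero hc.1
  obtain ⟨j, rfl⟩ := Nat.exists_eq_succ_of_ne_zero hc.2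
  have hpow : ∀ k : ℕ, 1 - a ^ (k + 1) ≠ 0 := fun k hk => by
    have : |a| ^ (k + 1) < 1 := pow_lt_one₀ (abs_nonneg a) (abs_lt.2 ⟨h1, h1'⟩) (by omega)
    rw [← abs_pow, show a ^ (k + 1) = 1 by linarith] at this
    simp at this
  have e1 := rootSum_path_add a i (j + 1)
  rw [show i + (j + 1) + 1 = i.succ + j.succ by omega] at e1
  have e2 := rootSum_path_add a i 0
  have e3 := one_sub_mul_rootSum_path a j
  simp only [path, rootSum, Nat.succ_eq_add_one] at h e1 e2
  rw [e1] at h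
  have : (1 - a ^ (i + 1)) * (a * rootSum a (path j)) = 0 := by linarith
  rcases mul_eq_zero.1 this with h2 | h2
  · exact hpow i h2
  · rcases mul_eq_zero.1 h2 with h2 | h2
    · exact h0 h2
    · rw [h2, mul_zero] at e3
      exact hpow j e3.symm

/-- A longest word of `A` is the parent of no other vertex of `A`. -/
theorem IsSubtreeAt.exists_leaf {r : UHN} {A : Finset UHN} (h : IsSubtreeAt r A)
    (hA : 2 ≤ A.card) : ∃ v ∈ A, v ≠ r ∧ IsSubtreeAt r (A.erase v) := by
  obtain ⟨v, hv, hmax⟩ := A.exists_max_image List.length ⟨r, h.1⟩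
  have hvr : v ≠ r := by
    rintro rfl
    obtain ⟨w, hw, hwv⟩ := Finset.exists_mem_ne (s := A) (by omega) v
    have hp := h.prefix_of_mem hw
    exact hwv (hp.eq_of_length_le (hmax w hw)).symm
  refine ⟨v, hv, hvr, Finset.mem_erase.2 ⟨hvr.symm, h.1⟩, fun u hu hur => ?_⟩
  have huA := Finset.mem_of_mem_erase hu
  obtain ⟨h1, h2⟩ := h.2 u huA hur
  refine ⟨h1, Finset.mem_erase.2 ⟨?_, h2⟩⟩
  rintro rfl
  have := hmax u huA
  have := length_parent_lt h1
  omega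

theorem isGeodesic_extend {n : ℕ} {x : ℕ → UHN} (h : IsGeodesic n x) {v : UHN}
    (hv : ∀ j < n, wdist v (x j) = n - j) : ∃ y, IsGeodesic (n + 1) y ∧
      (Finset.range (n + 1)).image y = insert v ((Finset.range n).image x) := by
  have hlt : ∀ i < n, Function.update x n v i = x i := fun i hi =>
    Function.update_of_ne (by omega) _ _
  refine ⟨Function.update x n v, fun i hi j hj => ?_, ?_⟩
  · rcases Nat.lt_succ_iff_lt_or_eq.1 hi with hi' | rfl <;>
      rcases Nat.lt_succ_iff_lt_or_eq.1 hj with hj' | rfl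
    · rw [hlt i hi', hlt j hj', h i hi' j hj']
    · rw [hlt i hi', Function.update_self, wdist_comm, hv i hi']; omega
    · rw [hlt j hj', Function.update_self, hv j hj']; omega
    · simp
  · rw [Finset.range_add_one, Finset.image_insert, Function.update_self]
    congr 1
    exact Finset.image_congr fun i hi => hlt i (by simpa using hi)

theorem IsGeodesic.reverse {n : ℕ} {x : ℕ → UHN} (h : IsGeodesic n x) :
    IsGeodesic n (fun i => x (n - 1 - i)) ∧
      (Finset.range n).image (fun i => x (n - 1 - i)) = (Finset.range n).image x := by
  refine ⟨fun i hi j hj => ?_, ?_⟩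
  · rw [h _ (by omega) _ (by omega)]; omega
  · ext u
    simp only [Finset.mem_image, Finset.mem_range]
    constructor
    · rintro ⟨i, hi, rfl⟩; exact ⟨n - 1 - i, by omega, rfl⟩
    · rintro ⟨i, hi, rfl⟩
      exact ⟨n - 1 - i, by omega, by rw [show n - 1 - (n - 1 - i) = i by omega]⟩

/-- A subtree with the distance sum of a line is a line. -/
theorem IsSubtreeAt.exists_isGeodesic {a : ℝ} (h1 : -1 < a) (h1' : a < 1) (h0 : a ≠ 0) {r : UHN}
    {A : Finset UHN} (h : IsSubtreeAt r A)
    (hA : distSum a A = pairSum a (path (A.card - 1))) :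
    ∃ x, IsGeodesic A.card x ∧ (Finset.range A.card).image x = A := by
  induction hn : A.card generalizing A with
  | zero =>
    rw [Finset.card_eq_zero] at hn
    exact absurd h.1 (by simp [hn])
  | succ n ih =>
  rcases Nat.eq_zero_or_pos n with rfl | hnpos
  · obtain ⟨u, rfl⟩ := Finset.card_eq_one.1 hn
    refine ⟨fun _ => u, fun i hi j hj => ?_, by simp⟩
    rw [wdist_self]; omega
  obtain ⟨v, hv, hvr, hB⟩ := h.exists_leaf (by omega)
  obtain ⟨hv1, hv2⟩ := h.2 v hv hvr
  set B := A.erase v with hBdef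
  have hcard : B.card = n := by rw [hBdef, Finset.card_erase_of_mem hv, hn]; rfl
  have hxB : parent v ∈ B := by
    refine Finset.mem_erase.2 ⟨fun hc => ?_, hv2⟩
    have := length_parent_lt hv1
    rw [hc] at this
    exact lt_irrefl _ this
  have hvB : v ∉ B := Finset.notMem_erase v A
  obtain ⟨-, hd⟩ := hB.insert_adj hxB hvB (graph_adj_iff.2 (Or.inr ⟨hv1, rfl⟩))
  obtain ⟨t, ht⟩ := hB.exists_represents hxB
  have hgr := ht.graft (represents_single v) hxB (Finset.disjoint_singleton_right.2 hvB)
    (fun u hu w hw => by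
      rw [Finset.mem_singleton.1 hw, wdist_comm, hd u hu, wdist_self, wdist_comm])
  rw [Finset.union_comm, ← Finset.insert_eq, hBdef, Finset.insert_erase hv] at hgr
  rw [hn, ← (hgr.2 a).2, Nat.add_sub_cancel, ← hcard, ← ht.1] at hA
  -- `e1` lets the induction hypothesis apply to `B`; `e2` will locate the parent of `v` at an end
  -- of the resulting line.
  obtain ⟨e1, e2⟩ := eq_path_of_pairSum_graft_single h1 h1' h0 hA
  rw [ht.1, (ht.2 a).2] at e1
  rw [ht.1, hcard, (ht.2 a).1] at e2
  obtain ⟨x, hx, hxB'⟩ := ih hB e1 hcard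
  obtain ⟨i, hi, hix⟩ := Finset.mem_image.1 (hxB' ▸ hxB)
  rw [Finset.mem_range] at hi
  have hins : insert v B = A := Finset.insert_erase hv
  rw [← hix, ← hxB', hx.distSumFrom_eq a hi,
    show n - 1 = i + (n - 1 - i) by omega, Nat.add_sub_cancel_left] at e2
  have hd' : ∀ j < n, wdist v (x j) = (i - j) + (j - i) + 1 := fun j hj => by
    rw [hd (x j) (hxB' ▸ Finset.mem_image_of_mem x (Finset.mem_range.2 hj)), ← hix,
      hx i hi j hj]
  -- The parent of `v` is the first or the last vertex; in the first case the line is reversed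
  -- before appending `v`.
  rcases eq_zero_of_rootSum_path_add_eq h1 h1' h0 _ _ e2 with hi0 | hi0
  · obtain ⟨hr1, hr2⟩ := hx.reverse
    obtain ⟨y, hy1, hy2⟩ := isGeodesic_extend hr1 (v := v) (fun j hj => by
      rw [hd' _ (by omega)]; omega)
    exact ⟨y, hy1, by rw [hy2, hr2, hxB', hins]⟩
  · obtain ⟨y, hy1, hy2⟩ := isGeodesic_extend hx (v := v) (fun j hj => by
      rw [hd' j hj]; omega)
    exact ⟨y, hy1, by rw [hy2, hxB', hins]⟩

theorem IsSubtree.isLine {a : ℝ} (h1 : -1 < a) (h1' : a < 1) (h0 : a ≠ 0) {A : Finset UHN}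
    (h : IsSubtree A) (hA : distSum a A = pairSum a (path (A.card - 1))) : IsLine A := by
  obtain ⟨r, hr⟩ := h.exists_isSubtreeAt
  obtain ⟨x, hx, hxA⟩ := hr.exists_isGeodesic h1 h1' h0 hA
  have := hx.isLine
  rwa [hxA] at this

theorem pairSum_path_lt_distSum {A : Finset UHN} (h : IsSubtree A) (hA : ¬ IsLine A) {a : ℝ}
    (h1 : -1 < a) (h1' : a < 1) (h0 : a ≠ 0) :
    pairSum a (path (A.card - 1)) < distSum a A :=
  (pairSum_path_le_distSum h h1.le h1'.le).lt_of_ne fun he => hA (h.isLine h1 h1' h0 he.symm)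

/-! ### The leftmost line and a subtree which is not a line -/

theorem isGeodesic_replicate (n : ℕ) : IsGeodesic n fun k => List.replicate k (1 : ℕ+) := by
  have : ∀ i j : ℕ, wdist (List.replicate i (1 : ℕ+)) (List.replicate j 1)
      = (i - j) + (j - i) := by
    intro i
    induction i with
    | zero => intro j; simp [wdist_nil_left]
    | succ i ih =>
      intro j
      cases j with
      | zero => simp [wdist, List.replicate_succ]
      | succ j => simp only [List.replicate_succ, wdist, if_true, ih]; omega
  exact fun i _ j _ => this i j

theorem card_markovLine (n : ℕ) : (markovLine n).card = n := by
  rw [markovLine, Finset.card_image_of_injOn (isGeodesic_replicate n).injOn, Finset.card_range]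

theorem isLine_markovLine (n : ℕ) : IsLine (markovLine n) := (isGeodesic_replicate n).isLine

theorem isSubtreeAt_markovLine {n : ℕ} (hn : 1 ≤ n) : IsSubtreeAt [] (markovLine n) := by
  refine ⟨Finset.mem_image.2 ⟨0, by simp; omega, rfl⟩, fun u hu hu0 => ⟨hu0, ?_⟩⟩
  obtain ⟨k, hk, rfl⟩ := Finset.mem_image.1 hu
  refine Finset.mem_image.2 ⟨k - 1, ?_, ?_⟩
  · rw [Finset.mem_range] at hk ⊢; omega
  · simp [parent]

/-- For `n ≥ 5` there is a subtree with `n` vertices that is not a line, and whose distance sums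
at `-1`, `0` and `1` are those of a line. -/
theorem exists_not_isLine {n : ℕ} (hn : 5 ≤ n) : ∃ A ∈ subtreesOfCard n, ¬ IsLine A ∧
    ∀ a : ℝ, (a = 0 ∨ a = 1 ∨ a = -1) → distSum a A = pairSum a (path (n - 1)) := by
  obtain ⟨k, rfl⟩ := Nat.exists_eq_add_of_le hn
  -- The tree is a line of `n - 1` vertices with a leaf `v` attached to its third vertex from the
  -- bottom: three legs of lengths `k + 1`, `2` and `1`, which takes at least five vertices. The
  -- depth of `v` has the parity of the next vertex `1^(k + 4)` of the line, so the bipartition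
  -- classes have the sizes of those of a line, and the sums at `-1` agree.
  set v : UHN := List.replicate (k + 1) 1 ++ [2] with hv
  have hv0 : v ≠ [] := by simp [hv]
  have hpv : parent v = List.replicate (k + 1) 1 := by simp [hv, parent]
  have hline := isSubtreeAt_markovLine (n := k + 4) (by omega)
  have hgeo := isGeodesic_replicate (k + 4)
  have hp : List.replicate (k + 1) 1 ∈ markovLine (k + 4) :=
    Finset.mem_image.2 ⟨k + 1, by simp, rfl⟩
  have hvn : v ∉ markovLine (k + 4) := fun hc => by
    obtain ⟨j, -, hj⟩ := Finset.mem_image.1 hc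
    have : (2 : ℕ+) ∈ List.replicate j (1 : ℕ+) := by
      have hj' : List.replicate j (1 : ℕ+) = v := hj
      rw [hj']; simp [hv]
    have := List.eq_of_mem_replicate this
    exact absurd this (by decide)
  obtain ⟨⟨r, hr⟩, hd⟩ := hline.insert_adj hp hvn (graph_adj_iff.2 (Or.inr ⟨hv0, hpv⟩))
  obtain ⟨t, ht⟩ := hline.exists_represents hp
  have hgr := ht.graft (represents_single v) hp (Finset.disjoint_singleton_right.2 hvn)
    (fun u hu w hw => by
      rw [Finset.mem_singleton.1 hw, wdist_comm, hd u hu, wdist_self, wdist_comm])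
  rw [Finset.union_comm, ← Finset.insert_eq] at hgr
  have hcard : (insert v (markovLine (k + 4))).card = 5 + k := by
    rw [Finset.card_insert_of_notMem hvn, card_markovLine]; omega
  have hroot : ∀ a : ℝ, rootSum a t = rootSum a (path (k + 1)) + rootSum a (path 2) - 1 :=
    fun a => by
      rw [(ht.2 a).1]
      have := hgeo.distSumFrom_eq a (i := k + 1) (by omega)
      rw [show k + 4 - 1 - (k + 1) = 2 by omega] at this
      exact this
  refine ⟨_, ⟨hr.isSubtree, hcard⟩, fun hl => ?_, fun a ha => ?_⟩
  -- Any value in `(-1, 1)` other than 0 would do: the vertex carrying `v` would have to be an end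
  -- of the line.
  · have h2 := hl.distSum_eq ⟨v, Finset.mem_insert_self _ _⟩ (1 / 2)
    rw [hcard, ← (hgr.2 _).2, show 5 + k - 1 = size t by rw [ht.1, card_markovLine]; omega] at h2
    have h3 := (eq_path_of_pairSum_graft_single (by norm_num) (by norm_num) (by norm_num) h2).2
    rw [hroot, ht.1, card_markovLine] at h3
    have := eq_zero_of_rootSum_path_add_eq (by norm_num) (by norm_num) (by norm_num) _ _ h3
    omega
  · rw [← (hgr.2 a).2]
    have hsz : size (BranchTree.graft t single) = 5 + k := hgr.1.trans hcard
    rcases ha with rfl | rfl | rfl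
    · rw [pairSum_zero, pairSum_zero, hsz, size_path]; congr 1; omega
    · rw [pairSum_one, pairSum_one, hsz, size_path, show 5 + k - 1 + 1 = 5 + k by omega]
    · rw [pairSum_neg_one, pairSum_neg_one, show 5 + k - 1 = k + 1 + 1 + 1 + 1 by omega]
      simp only [rootSum, hroot, path]
      ring

end UHN

/-! ### Polynomials of compact self-adjoint contractions -/

section Spectral

open Module.End

variable {E : Type*} [NormedAddCommGroup E] [InnerProductSpace ℝ E]
  {T : E →L[ℝ] E}

theorem aeval_apply_of_eigenvector {a : ℝ} {v : E} (hv : T v = a • v) (p : Polynomial ℝ) :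
    (Polynomial.aeval T p) v = p.eval a • v := by
  induction p using Polynomial.induction_on' with
  | add p q hp hq => simp [hp, hq, add_smul]
  | monomial n c =>
    have : ∀ n : ℕ, (T ^ n) v = a ^ n • v := fun n => by
      induction n with
      | zero => simp
      | succ n ih =>
        rw [pow_succ, mul_apply_eq_comp, hv, map_smul, ih, smul_smul, pow_succ']
    rw [Polynomial.aeval_monomial, Polynomial.eval_monomial, mul_apply_eq_comp, this,
      Algebra.algebraMap_eq_smul_one, smul_apply,
      one_apply_eq_self, smul_smul]

theorem inner_aeval_of_eigenvector (hT : (T : E →ₗ[ℝ] E).IsSymmetric) {a : ℝ} {v : E}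
    (hv : T v = a • v) (p : Polynomial ℝ) (x : E) :
    inner ℝ v ((Polynomial.aeval T p) x) = p.eval a * inner ℝ v x := by
  induction p using Polynomial.induction_on' with
  | add p q hp hq => simp [hp, hq, inner_add_right, add_mul]
  | monomial n c =>
    have : ∀ n : ℕ, inner ℝ v ((T ^ n) x) = a ^ n * inner ℝ v x := fun n => by
      induction n with
      | zero => simp
      | succ n ih =>
        have h := hT v ((T ^ n) x)
        rw [ContinuousLinearMap.coe_coe, hv, real_inner_smul_left, ih] at h
        rw [pow_succ', mul_apply_eq_comp, ← h,
          pow_succ']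
        ring
    rw [Polynomial.aeval_monomial, Polynomial.eval_monomial, mul_apply_eq_comp,
      Algebra.algebraMap_eq_smul_one, smul_apply,
      one_apply_eq_self, real_inner_smul_right, this]
    ring

theorem abs_le_one_of_eigenvector (hT1 : ‖T‖ ≤ 1) {a : ℝ} {v : E} (hv : T v = a • v)
    (h0 : v ≠ 0) : |a| ≤ 1 := by
  have h := T.le_of_opNorm_le hT1 v
  rw [hv, norm_smul, one_mul, Real.norm_eq_abs] at h
  exact le_of_mul_le_mul_right (by simpa using h) (norm_pos_iff.2 h0)

/-- The span of the eigenspaces is dense by the spectral theorem. On it the quadratic form is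
diagonal, with coefficients `p.eval a` at eigenvalues, which lie in `[-1, 1]` because `T` is a
contraction. -/
theorem inner_aeval_nonneg [CompleteSpace E] (hc : IsCompactOperator T)
    (hT : (T : E →ₗ[ℝ] E).IsSymmetric) (hT1 : ‖T‖ ≤ 1) {p : Polynomial ℝ}
    (hp : ∀ a : ℝ, |a| ≤ 1 → 0 ≤ p.eval a) (x : E) :
    0 ≤ inner ℝ x ((Polynomial.aeval T p) x) := by
  set M : Submodule ℝ E := ⨆ a : ℝ, eigenspace (T : Module.End ℝ E) a with hM
  have hdense : M.topologicalClosure = ⊤ := by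
    rw [Submodule.topologicalClosure_eq_top_iff]
    exact ContinuousLinearMap.orthogonalComplement_iSup_eigenspaces_eq_bot hc hT
  have hclosed : IsClosed {x : E | 0 ≤ inner ℝ x ((Polynomial.aeval T p) x)} :=
    isClosed_le continuous_const (by fun_prop)
  have hsub : (M : Set E) ⊆ {x : E | 0 ≤ inner ℝ x ((Polynomial.aeval T p) x)} := by
    intro x hx
    obtain ⟨g, hg, rfl⟩ := (Submodule.mem_iSup_iff_exists_finsupp _ x).1 hx
    have hgT : ∀ a, T (g a) = a • g a := fun a => mem_eigenspace_iff.1 (hg a)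
    have horth : ∀ a b, a ≠ b → inner ℝ (g a) (g b) = 0 := fun a b hab => by
      have h := hT (g a) (g b)
      rw [ContinuousLinearMap.coe_coe, hgT, hgT, real_inner_smul_left, real_inner_smul_right] at h
      have : (a - b) * inner ℝ (g a) (g b) = 0 := by linarith
      exact (mul_eq_zero.1 this).resolve_left (sub_ne_zero.2 hab)
    rw [Set.mem_ofPred_eq, Finsupp.sum, sum_inner]
    refine Finset.sum_nonneg fun a ha => ?_
    rw [inner_aeval_of_eigenvector hT (hgT a), inner_sum]
    rw [Finset.sum_eq_single a (fun b _ hb => horth a b hb.symm) (fun h => absurd ha h)]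
    exact mul_nonneg (hp a (abs_le_one_of_eigenvector hT1 (hgT a) (Finsupp.mem_support_iff.1 ha)))
      real_inner_self_nonneg
  have hx : x ∈ closure (M : Set E) := by
    rw [← Submodule.topologicalClosure_coe, hdense]; trivial
  exact closure_minimal hsub hclosed hx

/-- Subtract from `x` its projections to the three kernels. If the claim failed, the remainder would
be orthogonal to all eigenspaces, hence zero, and `x` would lie in the sum of the kernels. -/
theorem exists_eigenvector_inner_ne_zero [CompleteSpace E] (hc : IsCompactOperator T)
    (hT : (T : E →ₗ[ℝ] E).IsSymmetric) {x : E}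
    (hx : x ∉ LinearMap.ker T.toLinearMap ⊔ LinearMap.ker (T - 1).toLinearMap ⊔
      LinearMap.ker (T + 1).toLinearMap) :
    ∃ (a : ℝ) (v : E), T v = a • v ∧ inner ℝ v x ≠ 0 ∧ a ≠ 0 ∧ a ≠ 1 ∧ a ≠ -1 := by
  by_contra! hcon
  have horth : ∀ {a b : ℝ} {v w : E}, T v = a • v → T w = b • w → a ≠ b →
      inner ℝ v w = 0 := fun {a b v w} hv hw hab => by
    have h := hT v w
    rw [ContinuousLinearMap.coe_coe, hv, hw, real_inner_smul_left, real_inner_smul_right] at h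
    have : (a - b) * inner ℝ v w = 0 := by linarith
    exact (mul_eq_zero.1 this).resolve_left (sub_ne_zero.2 hab)
  have hproj : ∀ S : E →L[ℝ] E, ∃ y ∈ LinearMap.ker S.toLinearMap,
      ∀ v ∈ LinearMap.ker S.toLinearMap, inner ℝ v (x - y) = 0 := fun S => by
    have : CompleteSpace (LinearMap.ker S.toLinearMap) :=
      (ContinuousLinearMap.isClosed_ker S).completeSpace_coe
    refine ⟨(LinearMap.ker S.toLinearMap).starProjection x,
      Submodule.starProjection_apply_mem _ x, fun v hv => ?_⟩
    exact Submodule.sub_starProjection_mem_orthogonal x v hv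
  have h0 : ∀ v, v ∈ LinearMap.ker T.toLinearMap ↔ T v = (0 : ℝ) • v := fun v => by simp
  have h1 : ∀ v, v ∈ LinearMap.ker (T - 1).toLinearMap ↔ T v = (1 : ℝ) • v := fun v => by
    simp [sub_eq_zero]
  have h2 : ∀ v, v ∈ LinearMap.ker (T + 1).toLinearMap ↔ T v = (-1 : ℝ) • v := fun v => by
    simp [add_eq_zero_iff_eq_neg]
  obtain ⟨y0, hy0, hy0'⟩ := hproj T
  obtain ⟨y1, hy1, hy1'⟩ := hproj (T - 1)
  obtain ⟨y2, hy2, hy2'⟩ := hproj (T + 1)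
  have hz : x - y0 - y1 - y2 ∈ (⨆ a : ℝ, eigenspace (T : Module.End ℝ E) a)ᗮ := by
    rw [← Submodule.iInf_orthogonal, Submodule.mem_iInf]
    intro a v hv
    have hva : T v = a • v := mem_eigenspace_iff.1 hv
    rw [inner_sub_right, inner_sub_right, inner_sub_right]
    have e0 : a ≠ 0 → inner ℝ v y0 = 0 := fun h => horth hva ((h0 _).1 hy0) h
    have e1 : a ≠ 1 → inner ℝ v y1 = 0 := fun h => horth hva ((h1 _).1 hy1) h
    have e2 : a ≠ -1 → inner ℝ v y2 = 0 := fun h => horth hva ((h2 _).1 hy2) h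
    by_cases ha0 : a = 0
    · have := hy0' v ((h0 v).2 (ha0 ▸ hva))
      rw [inner_sub_right] at this
      rw [e1 (by rw [ha0]; norm_num), e2 (by rw [ha0]; norm_num)]; linarith
    by_cases ha1 : a = 1
    · have := hy1' v ((h1 v).2 (ha1 ▸ hva))
      rw [inner_sub_right] at this
      rw [e0 ha0, e2 (by rw [ha1]; norm_num)]; linarith
    by_cases ha2 : a = -1
    · have := hy2' v ((h2 v).2 (ha2 ▸ hva))
      rw [inner_sub_right] at this
      rw [e0 ha0, e1 ha1]; linarith
    rw [e0 ha0, e1 ha1, e2 ha2]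
    by_contra hne
    exact ha2 (hcon a v hva (by simpa using hne) ha0 ha1)
  rw [ContinuousLinearMap.orthogonalComplement_iSup_eigenspaces_eq_bot hc hT,
    Submodule.mem_bot] at hz
  refine hx ?_
  rw [show x = y0 + y1 + y2 by rw [← sub_eq_zero, ← hz]; abel]
  exact Submodule.add_mem_sup (Submodule.add_mem_sup hy0 hy1) hy2

/-- Split `x = c • v + y` along one eigenvector with eigenvalue outside `{-1, 0, 1}` and not
orthogonal to `x`. The cross terms vanish, the `v` part is positive and the `y` part is nonnegative.
-/
theorem inner_aeval_pos [CompleteSpace E] (hc : IsCompactOperator T)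
    (hT : (T : E →ₗ[ℝ] E).IsSymmetric) (hT1 : ‖T‖ ≤ 1) {p : Polynomial ℝ}
    (hp : ∀ a : ℝ, |a| ≤ 1 → 0 ≤ p.eval a)
    (hp' : ∀ a : ℝ, -1 < a → a < 1 → a ≠ 0 → 0 < p.eval a) {x : E}
    (hx : x ∉ LinearMap.ker T.toLinearMap ⊔ LinearMap.ker (T - 1).toLinearMap ⊔
      LinearMap.ker (T + 1).toLinearMap) :
    0 < inner ℝ x ((Polynomial.aeval T p) x) := by
  obtain ⟨a, v, hv, hvx, ha0, ha1, ha2⟩ := exists_eigenvector_inner_ne_zero hc hT hx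
  have hv0 : v ≠ 0 := by rintro rfl; simp at hvx
  have habs := abs_le.1 (abs_le_one_of_eigenvector hT1 hv hv0)
  have hpa := hp' a (lt_of_le_of_ne habs.1 (Ne.symm ha2)) (lt_of_le_of_ne habs.2 ha1) ha0
  have hvv : 0 < inner ℝ v v := real_inner_self_pos.2 hv0
  set c := inner ℝ v x / inner ℝ v v with hcdef
  have hc0 : c ≠ 0 := div_ne_zero hvx hvv.ne'
  set y := x - c • v with hy
  have hvy : inner ℝ v y = 0 := by
    rw [hy, inner_sub_right, real_inner_smul_right, hcdef, div_mul_cancel₀ _ hvv.ne', sub_self]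
  have hxy : x = c • v + y := by rw [hy]; abel
  have h1 := inner_aeval_of_eigenvector hT hv p v
  have h2 := inner_aeval_of_eigenvector hT hv p y
  rw [hvy, mul_zero] at h2
  have h3 : inner ℝ y ((Polynomial.aeval T p) v) = 0 := by
    rw [aeval_apply_of_eigenvector hv, real_inner_smul_right, real_inner_comm, hvy, mul_zero]
  have h4 := inner_aeval_nonneg hc hT hT1 hp y
  rw [hxy, map_add, map_smul, inner_add_left, inner_add_right, inner_add_right,
    real_inner_smul_left, real_inner_smul_left, real_inner_smul_right, real_inner_smul_right,
    h1, h2, h3]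
  have : 0 < c * c := mul_self_pos.2 hc0
  have := mul_pos this (mul_pos hpa hvv)
  nlinarith

theorem aeval_eq_zero_of_mem_ker {p : Polynomial ℝ}
    (hp : ∀ a : ℝ, (a = 0 ∨ a = 1 ∨ a = -1) → p.eval a = 0) {x : E}
    (hx : x ∈ LinearMap.ker T.toLinearMap ⊔ LinearMap.ker (T - 1).toLinearMap ⊔
      LinearMap.ker (T + 1).toLinearMap) :
    (Polynomial.aeval T p) x = 0 := by
  obtain ⟨z, hz, w, hw, rfl⟩ := Submodule.mem_sup.1 hx
  obtain ⟨u, hu, v, hv, rfl⟩ := Submodule.mem_sup.1 hz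
  have hu' : T u = (0 : ℝ) • u := by simpa using hu
  have hv' : T v = (1 : ℝ) • v := by simpa [sub_eq_zero] using hv
  have hw' : T w = (-1 : ℝ) • w := by simpa [add_eq_zero_iff_eq_neg] using hw
  rw [map_add, map_add, aeval_apply_of_eigenvector hu', aeval_apply_of_eigenvector hv',
    aeval_apply_of_eigenvector hw', hp 0 (by simp), hp 1 (by simp), hp (-1) (by simp)]
  simp

end Spectral

/-! ### Covariances of a branching Markov process -/

namespace UHN

theorem Explores.isSubtreeAt {l : List UHN} {T : Finset UHN} (h : Explores l T) :
    IsSubtreeAt [] T := by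
  induction h with
  | root => exact ⟨Finset.mem_singleton_self _, fun u hu h => absurd (Finset.mem_singleton.1 hu) h⟩
  | @graft l T v _ hv hp ih =>
    refine ⟨Finset.mem_insert_of_mem ih.1, fun u hu h => ⟨h, ?_⟩⟩
    rcases Finset.mem_insert.1 hu with rfl | hu
    · exact Finset.mem_insert_of_mem hp
    · exact Finset.mem_insert_of_mem (ih.2 u hu h).2

theorem Explores.exists_insert {l : List UHN} {T : Finset UHN} (h : Explores l T) (v : UHN) :
    ∃ l' T', Explores l' T' ∧ T ⊆ T' ∧ v ∈ T' := by
  induction hn : v.length using Nat.strong_induction_on generalizing v with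
  | _ n ih =>
  by_cases hv0 : v = []
  · exact ⟨l, T, h, subset_rfl, hv0 ▸ h.isSubtreeAt.1⟩
  obtain ⟨l', T', h', hT, hp⟩ := ih _ (hn ▸ length_parent_lt hv0) (parent v) rfl
  by_cases hv : v ∈ T'
  · exact ⟨l', T', h', hT, hv⟩
  · exact ⟨_, _, h'.graft hv hp, hT.trans (Finset.subset_insert _ _), Finset.mem_insert_self _ _⟩

theorem exists_explores (u v : UHN) : ∃ l T, Explores l T ∧ u ∈ T ∧ v ∈ T := by
  obtain ⟨l, T, h, -, hu⟩ := Explores.root.exists_insert u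
  obtain ⟨l', T', h', hT, hv⟩ := h.exists_insert v
  exact ⟨l', T', h', hT hu, hv⟩

end UHN

section Branching

variable {𝓧 : Type*} [MeasurableSpace 𝓧] {Q : Kernel 𝓧 𝓧} [IsMarkovKernel Q] {μ : Measure 𝓧}
  [IsProbabilityMeasure μ]

instance isProbabilityMeasure_branchLaw (l : List UHN) : IsProbabilityMeasure (branchLaw μ Q l) := by
  induction l with
  | nil => exact Measure.isProbabilityMeasure_map (by fun_prop)
  | cons v l ih => rw [branchLaw]; infer_instance

/-- As the image of a composition-product, one step of the exploration turns integrals into iterated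
ones. -/
theorem branchLaw_cons (v : UHN) (l : List UHN) :
    branchLaw μ Q (v :: l) = ((branchLaw μ Q l) ⊗ₘ
      (Q.comap (fun x : UHN → 𝓧 => x (UHN.parent v)) (measurable_pi_apply _))).map
        (fun p => Function.update p.1 v p.2) := by
  rw [Measure.compProd_eq_comp_prod, Measure.map_comp _ _ (measurable_branchUpdate v)]
  rfl

theorem map_eval_branchLaw_of_ne {u v : UHN} (huv : u ≠ v) (l : List UHN) :
    (branchLaw μ Q (v :: l)).map (fun x => x u) = (branchLaw μ Q l).map (fun x => x u) := by
  rw [branchLaw_cons, Measure.map_map (by fun_prop) (measurable_branchUpdate v)]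
  have : (fun x : UHN → 𝓧 => x u) ∘ (fun p : (UHN → 𝓧) × 𝓧 => Function.update p.1 v p.2)
      = (fun x : UHN → 𝓧 => x u) ∘ Prod.fst := by
    ext p; simp [Function.update_of_ne huv]
  rw [this, ← Measure.map_map (by fun_prop) measurable_fst]
  congr 1
  exact Measure.fst_compProd _ _

theorem map_eval_branchLaw_self (v : UHN) (l : List UHN) :
    (branchLaw μ Q (v :: l)).map (fun x => x v)
      = ((branchLaw μ Q l).map (fun x => x (UHN.parent v))).bind Q := by
  rw [branchLaw_cons, Measure.map_map (by fun_prop) (measurable_branchUpdate v)]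
  have : (fun x : UHN → 𝓧 => x v) ∘ (fun p : (UHN → 𝓧) × 𝓧 => Function.update p.1 v p.2)
      = Prod.snd := by
    ext p; simp
  rw [this]
  change Measure.snd _ = _
  rw [Measure.snd_compProd]
  ext s hs
  rw [Measure.bind_apply hs (Kernel.aemeasurable _), Measure.bind_apply hs (Kernel.aemeasurable _),
    lintegral_map (Kernel.measurable_coe Q hs) (by fun_prop)]
  rfl

theorem map_eval_branchLaw (hQ : Kernel.Invariant Q μ) {l : List UHN} {T : Finset UHN}
    (h : UHN.Explores l T) {u : UHN} (hu : u ∈ T) :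
    (branchLaw μ Q l).map (fun x => x u) = μ := by
  induction h generalizing u with
  | root =>
    rw [branchLaw, Measure.map_map (by fun_prop) (by fun_prop)]
    exact Measure.map_id
  | @graft l T v _ hv hp ih =>
    rcases Finset.mem_insert.1 hu with rfl | hu
    · rw [map_eval_branchLaw_self, ih hp, hQ.def]
    · rw [map_eval_branchLaw_of_ne (ne_of_mem_of_not_mem hu hv), ih hu]

omit [IsProbabilityMeasure μ] in
theorem kernelOperator_toLp (hQ : Kernel.Invariant Q μ) {g : 𝓧 → ℝ} (hg : MemLp g 2 μ) :
    kernelOperator Q μ hQ (hg.toLp g)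
      = (memLp_kernelAverage hQ hg).toLp (kernelAverage Q g) := by
  change (memLp_kernelAverage hQ (Lp.memLp (hg.toLp g))).toLp (kernelAverage Q (hg.toLp g)) = _
  rw [MemLp.toLp_eq_toLp_iff]
  exact kernelAverage_congr hQ hg.coeFn_toLp

omit [IsProbabilityMeasure μ] in
theorem inner_toLp {f g : 𝓧 → ℝ} (hf : MemLp f 2 μ) (hg : MemLp g 2 μ) :
    inner ℝ (hf.toLp f) (hg.toLp g) = ∫ x, f x * g x ∂μ := by
  rw [L2.inner_def]
  refine integral_congr_ae ?_
  filter_upwards [hf.coeFn_toLp, hg.coeFn_toLp] with x h1 h2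
  rw [h1, h2]
  simp [mul_comm]

theorem memLp_eval_branchLaw (hQ : Kernel.Invariant Q μ) {l : List UHN} {T : Finset UHN}
    (h : UHN.Explores l T) {u : UHN} (hu : u ∈ T) {f : 𝓧 → ℝ} (hf : MemLp f 2 μ) :
    MemLp (fun x : UHN → 𝓧 => f (x u)) 2 (branchLaw μ Q l) :=
  hf.comp_measurePreserving ⟨measurable_pi_apply u, map_eval_branchLaw hQ h hu⟩

/-- Induction along the exploration: integrating out the newest vertex `w` replaces `g` at `w` by `Q
g` at its parent, which is one step closer to every earlier vertex. Symmetry of the powers of `Q`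
allows either argument to be the newest. -/
theorem integral_mul_branchLaw (hQ : Kernel.Invariant Q μ)
    (hsa : (kernelOperator Q μ hQ : Lp ℝ 2 μ →ₗ[ℝ] Lp ℝ 2 μ).IsSymmetric) {l : List UHN}
    {T : Finset UHN} (h : UHN.Explores l T) {u v : UHN} (hu : u ∈ T) (hv : v ∈ T) {f g : 𝓧 → ℝ}
    (hfm : StronglyMeasurable f) (hf : MemLp f 2 μ) (hgm : StronglyMeasurable g)
    (hg : MemLp g 2 μ) :
    ∫ x, f (x u) * g (x v) ∂(branchLaw μ Q l) =
      inner ℝ (hf.toLp f) ((kernelOperator Q μ hQ ^ UHN.wdist u v) (hg.toLp g)) := by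
  have hpow : ∀ k : ℕ, ∀ x y : Lp ℝ 2 μ, inner ℝ x ((kernelOperator Q μ hQ ^ k) y)
      = inner ℝ y ((kernelOperator Q μ hQ ^ k) x) := by
    intro k
    induction k with
    | zero => intro x y; exact real_inner_comm _ _
    | succ k ih =>
      intro x y
      conv_lhs => rw [pow_succ, mul_apply_eq_comp, ih]
      conv_rhs => rw [pow_succ', mul_apply_eq_comp]
      exact hsa y _
  have hdiag : ∀ {l : List UHN} {T : Finset UHN} (_ : UHN.Explores l T) {u : UHN} (_ : u ∈ T)
      {f g : 𝓧 → ℝ} (_ : StronglyMeasurable f) (hf : MemLp f 2 μ) (_ : StronglyMeasurable g)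
      (hg : MemLp g 2 μ), ∫ x, f (x u) * g (x u) ∂(branchLaw μ Q l) =
        inner ℝ (hf.toLp f) ((kernelOperator Q μ hQ ^ UHN.wdist u u) (hg.toLp g)) := by
    intro l T h u hu f g hfm hf hgm hg
    rw [UHN.wdist_self, pow_zero, one_apply_eq_self, inner_toLp]
    conv_rhs => rw [← map_eval_branchLaw hQ h hu]
    exact (integral_map (φ := fun x : UHN → 𝓧 => x u) (f := fun y => f y * g y)
      (measurable_pi_apply u).aemeasurable (hfm.mul hgm).aestronglyMeasurable).symm
  induction h generalizing u v f g with
  | root =>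
    rw [Finset.mem_singleton.1 hu, Finset.mem_singleton.1 hv]
    exact hdiag UHN.Explores.root (Finset.mem_singleton_self _) hfm hf hgm hg
  | @graft l T w h hw hp ih =>
    have h' := h.graft hw hp
    have hd := h.isSubtreeAt.insert_adj hp hw (by
      rw [UHN.graph_adj_iff_wdist]
      refine UHN.wdist_parent ?_
      rintro rfl
      exact hw h.isSubtreeAt.1)
    have hprod : ∀ u ∈ insert w T, ∀ v ∈ insert w T, ∀ f g : 𝓧 → ℝ, MemLp f 2 μ → MemLp g 2 μ →
        Integrable (fun x => f (x u) * g (x v)) (branchLaw μ Q (w :: l)) :=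
      fun u hu v hv f g hf hg =>
        (memLp_eval_branchLaw hQ h' hu hf).integrable_mul (memLp_eval_branchLaw hQ h' hv hg)
    have hstep : ∀ u ∈ insert w T, ∀ v ∈ insert w T, ∀ f g : 𝓧 → ℝ, StronglyMeasurable f →
        StronglyMeasurable g → MemLp f 2 μ → MemLp g 2 μ →
        ∫ x, f (x u) * g (x v) ∂(branchLaw μ Q (w :: l)) =
          ∫ x, ∫ y, f (Function.update x w y u) * g (Function.update x w y v)
            ∂(Q (x (UHN.parent w))) ∂(branchLaw μ Q l) := by
      intro u hu v hv f g hfm hgm hf hg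
      have hsm : StronglyMeasurable fun x : UHN → 𝓧 => f (x u) * g (x v) :=
        (hfm.comp_measurable (measurable_pi_apply u)).mul
          (hgm.comp_measurable (measurable_pi_apply v))
      have hint := hprod u hu v hv f g hf hg
      rw [branchLaw_cons] at hint ⊢
      rw [integral_map (measurable_branchUpdate w).aemeasurable hsm.aestronglyMeasurable]
      exact Measure.integral_compProd (hint.comp_measurable (measurable_branchUpdate w))
    have hnew : ∀ u ∈ T, ∀ f g : 𝓧 → ℝ, StronglyMeasurable f → StronglyMeasurable g →
        ∀ (hf : MemLp f 2 μ) (hg : MemLp g 2 μ),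
        ∫ x, f (x u) * g (x w) ∂(branchLaw μ Q (w :: l)) =
          inner ℝ (hf.toLp f) ((kernelOperator Q μ hQ ^ UHN.wdist u w) (hg.toLp g)) := by
      intro u hu f g hfm hgm hf hg
      rw [hstep u (Finset.mem_insert_of_mem hu) w (Finset.mem_insert_self _ _) f g hfm hgm hf hg]
      have huw : u ≠ w := ne_of_mem_of_not_mem hu hw
      simp only [Function.update_self, Function.update_of_ne huw, integral_const_mul]
      have := ih hu hp hfm hf (g := kernelAverage Q g)
        (StronglyMeasurable.integral_kernel (κ := Q) hgm) (memLp_kernelAverage hQ hg)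
      rw [UHN.wdist_comm u w, hd.2 u hu, UHN.wdist_comm, pow_succ, mul_apply_eq_comp,
        kernelOperator_toLp hQ hg, ← this]
      rfl
    rcases Finset.mem_insert.1 hu with rfl | huT <;> rcases Finset.mem_insert.1 hv with rfl | hvT
    · exact hdiag h' hu hfm hf hgm hg
    · rw [hpow, UHN.wdist_comm, ← hnew v hvT g f hgm hfm hg hf]
      exact integral_congr_ae (Filter.Eventually.of_forall fun x => mul_comm _ _)
    · exact hnew u huT f g hfm hgm hf hg
    · rw [hstep u hu v hv f g hfm hgm hf hg, ← ih huT hvT hfm hf hgm hg]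
      have h1 : u ≠ w := ne_of_mem_of_not_mem huT hw
      have h2 : v ≠ w := ne_of_mem_of_not_mem hvT hw
      simp [Function.update_of_ne h1, Function.update_of_ne h2]

variable {Ω : Type*} [MeasurableSpace Ω] {P : Measure Ω} {X : UHN → Ω → 𝓧}

theorem IsBranchingMarkovProcess.measurePreserving (hX : IsBranchingMarkovProcess P X Q μ)
    (hQ : Kernel.Invariant Q μ) (u : UHN) : MeasurePreserving (X u) P μ := by
  refine ⟨hX.measurable u, ?_⟩
  obtain ⟨l, T, h, hu, -⟩ := UHN.exists_explores u u
  have hlaw := hX.law T l h.isSubtreeAt.isSubtree h.isSubtreeAt.1 h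
  have := congrArg (fun m => m.map fun y : T → 𝓧 => y ⟨u, hu⟩) hlaw
  have hm : Measurable fun ω (u : T) => X u ω := measurable_pi_lambda _ fun i => hX.measurable i
  rw [Measure.map_map (by fun_prop) hm,
    Measure.map_map (by fun_prop) (by fun_prop)] at this
  exact this.trans (map_eval_branchLaw hQ h hu)

theorem IsBranchingMarkovProcess.integral_mul (hX : IsBranchingMarkovProcess P X Q μ)
    (hQ : Kernel.Invariant Q μ)
    (hsa : (kernelOperator Q μ hQ : Lp ℝ 2 μ →ₗ[ℝ] Lp ℝ 2 μ).IsSymmetric)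
    {f : 𝓧 → ℝ} (hf : MemLp f 2 μ) (u v : UHN) :
    ∫ ω, f (X u ω) * f (X v ω) ∂P =
      inner ℝ (hf.toLp f) ((kernelOperator Q μ hQ ^ UHN.wdist u v) (hf.toLp f)) := by
  obtain ⟨l, T, h, hu, hv⟩ := UHN.exists_explores u v
  have hlaw := hX.law T l h.isSubtreeAt.isSubtree h.isSubtreeAt.1 h
  -- `f` is only almost everywhere strongly measurable for `μ`; a strongly measurable version can be
  -- integrated against the image measures, and each `X w` preserves the almost everywhere equality.
  set g := hf.1.mk f with hg
  have hgm : StronglyMeasurable g := hf.1.stronglyMeasurable_mk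
  have hfg : f =ᵐ[μ] g := hf.1.ae_eq_mk
  have hgL : MemLp g 2 μ := hf.ae_eq hfg
  have hLp : hf.toLp f = hgL.toLp g := (MemLp.toLp_eq_toLp_iff _ _).2 hfg
  have hae : ∀ w, ∀ᵐ ω ∂P, f (X w ω) = g (X w ω) := fun w =>
    (hX.measurePreserving hQ w).quasiMeasurePreserving.ae hfg
  have h1 : ∫ ω, f (X u ω) * f (X v ω) ∂P = ∫ ω, g (X u ω) * g (X v ω) ∂P := by
    refine integral_congr_ae ?_
    filter_upwards [hae u, hae v] with ω e1 e2
    rw [e1, e2]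
  have hsm : StronglyMeasurable fun y : T → 𝓧 => g (y ⟨u, hu⟩) * g (y ⟨v, hv⟩) :=
    (hgm.comp_measurable (measurable_pi_apply _)).mul (hgm.comp_measurable (measurable_pi_apply _))
  have h2 := congrArg (fun m => ∫ y : T → 𝓧, g (y ⟨u, hu⟩) * g (y ⟨v, hv⟩) ∂m) hlaw
  have hm : Measurable fun ω (u : T) => X u ω := measurable_pi_lambda _ fun i => hX.measurable i
  have hr : Measurable fun (x : UHN → 𝓧) (u : T) => x u := by fun_prop
  beta_reduce at h2
  rw [integral_map hm.aemeasurable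
      hsm.aestronglyMeasurable, integral_map hr.aemeasurable hsm.aestronglyMeasurable] at h2
  rw [h1, h2, hLp]
  exact integral_mul_branchLaw hQ hsa h hu hv hgm hgL hgm hgL

end Branching

/-! ### Variances of empirical averages -/

namespace UHN

/-- The polynomial `∑_{u, v ∈ A} a ^ d(u, v)` in the variable `a`. -/
noncomputable def distPoly (A : Finset UHN) : Polynomial ℝ :=
  ∑ u ∈ A, ∑ v ∈ A, Polynomial.X ^ wdist u v

theorem eval_distPoly (a : ℝ) (A : Finset UHN) : (distPoly A).eval a = distSum a A := by
  simp [distPoly, distSum, Polynomial.eval_finsetSum]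

theorem markovLine_mem_subtreesOfCard {n : ℕ} (hn : 1 ≤ n) :
    markovLine n ∈ subtreesOfCard n :=
  ⟨(isSubtreeAt_markovLine hn).isSubtree, card_markovLine n⟩

end UHN

section Variance

variable {𝓧 : Type*} [MeasurableSpace 𝓧] {Q : Kernel 𝓧 𝓧} [IsMarkovKernel Q] {μ : Measure 𝓧}
  [IsProbabilityMeasure μ]

omit [IsProbabilityMeasure μ] in
theorem norm_kernelOperator_le (hQ : Kernel.Invariant Q μ) : ‖kernelOperator Q μ hQ‖ ≤ 1 :=
  LinearMap.mkContinuous_norm_le _ zero_le_one _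

variable {Ω : Type*} [MeasurableSpace Ω] {P : Measure Ω}
  {X : UHN → Ω → 𝓧} {f : 𝓧 → ℝ}

theorem IsBranchingMarkovProcess.memLp_comp (hX : IsBranchingMarkovProcess P X Q μ)
    (hQ : Kernel.Invariant Q μ) (hf : MemLp f 2 μ) (u : UHN) :
    MemLp (fun ω => f (X u ω)) 2 P :=
  hf.comp_measurePreserving (hX.measurePreserving hQ u)

theorem IsBranchingMarkovProcess.memLp_empiricalAverage (hX : IsBranchingMarkovProcess P X Q μ)
    (hQ : Kernel.Invariant Q μ) (hf : MemLp f 2 μ) (A : Finset UHN) :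
    MemLp (empiricalAverage X f A) 2 P :=
  (memLp_finsetSum A fun u _ => hX.memLp_comp hQ hf u).const_mul _

variable [IsProbabilityMeasure P]

theorem IsBranchingMarkovProcess.integral_empiricalAverage
    (hX : IsBranchingMarkovProcess P X Q μ) (hQ : Kernel.Invariant Q μ) (hf : MemLp f 2 μ)
    {A : Finset UHN} (hA : A.Nonempty) :
    ∫ ω, empiricalAverage X f A ω ∂P = ∫ x, f x ∂μ := by
  have h : ∀ u, ∫ ω, f (X u ω) ∂P = ∫ x, f x ∂μ := fun u => by
    have hu := hX.measurePreserving hQ u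
    conv_rhs => rw [← hu.map_eq]
    exact (integral_map hu.measurable.aemeasurable (hu.map_eq ▸ hf.1)).symm
  have hc : (A.card : ℝ) ≠ 0 := Nat.cast_ne_zero.2 hA.card_ne_zero
  simp only [empiricalAverage]
  rw [integral_const_mul,
    integral_finsetSum _ fun u _ => (hX.memLp_comp hQ hf u).integrable (by norm_num)]
  simp [h, hc]

theorem IsBranchingMarkovProcess.variance_empiricalAverage
    (hX : IsBranchingMarkovProcess P X Q μ) (hQ : Kernel.Invariant Q μ)
    (hsa : (kernelOperator Q μ hQ : Lp ℝ 2 μ →ₗ[ℝ] Lp ℝ 2 μ).IsSymmetric) (hf : MemLp f 2 μ)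
    {A : Finset UHN} (hA : A.Nonempty) :
    variance (empiricalAverage X f A) P = ((A.card : ℝ)⁻¹) ^ 2 *
      inner ℝ (hf.toLp f) (Polynomial.aeval (kernelOperator Q μ hQ) (UHN.distPoly A) (hf.toLp f))
        - (∫ x, f x ∂μ) ^ 2 := by
  rw [variance_eq_sub (hX.memLp_empiricalAverage hQ hf A),
    hX.integral_empiricalAverage hQ hf hA]
  congr 1
  have h : ∀ ω, (empiricalAverage X f A ^ 2) ω
      = ((A.card : ℝ)⁻¹) ^ 2 * ∑ u ∈ A, ∑ v ∈ A, f (X u ω) * f (X v ω) := fun ω => by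
    rw [Pi.pow_apply, empiricalAverage, mul_pow, sq (∑ u ∈ A, _), Finset.sum_mul_sum]
  have hint : ∀ u v, Integrable (fun ω => f (X u ω) * f (X v ω)) P := fun u v =>
    (hX.memLp_comp hQ hf u).integrable_mul (hX.memLp_comp hQ hf v)
  simp only [h]
  rw [integral_const_mul,
    integral_finsetSum _ fun u _ => integrable_finsetSum _ fun v _ => hint u v]
  congr 1
  simp only [UHN.distPoly, map_sum, map_pow, Polynomial.aeval_X, sum_apply,
    inner_sum]
  refine Finset.sum_congr rfl fun u _ => ?_
  rw [integral_finsetSum _ fun v _ => hint u v]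
  exact Finset.sum_congr rfl fun v _ => hX.integral_mul hQ hsa hf u v

theorem IsBranchingMarkovProcess.variance_sub_variance
    (hX : IsBranchingMarkovProcess P X Q μ) (hQ : Kernel.Invariant Q μ)
    (hsa : (kernelOperator Q μ hQ : Lp ℝ 2 μ →ₗ[ℝ] Lp ℝ 2 μ).IsSymmetric) (hf : MemLp f 2 μ)
    {A B : Finset UHN} (hB : B.Nonempty) (h : A.card = B.card) :
    variance (empiricalAverage X f A) P - variance (empiricalAverage X f B) P =
      ((B.card : ℝ)⁻¹) ^ 2 * inner ℝ (hf.toLp f)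
        (Polynomial.aeval (kernelOperator Q μ hQ) (UHN.distPoly A - UHN.distPoly B)
          (hf.toLp f)) := by
  have hA : A.Nonempty := Finset.card_pos.1 (h ▸ hB.card_pos)
  rw [hX.variance_empiricalAverage hQ hsa hf hA, hX.variance_empiricalAverage hQ hsa hf hB, h,
    map_sub, sub_apply, inner_sub_right]
  ring

end Variance

/-! ### The proposition -/

theorem mainTheorem2 {𝓧 : Type*} [MeasurableSpace 𝓧]
    (Q : Kernel 𝓧 𝓧) [IsMarkovKernel Q]
    (μ : Measure 𝓧) [IsProbabilityMeasure μ] (hμ : Kernel.Invariant Q μ)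
    (hsa : IsSelfAdjoint (kernelOperator Q μ hμ))
    (hcomp : IsCompactOperator (kernelOperator Q μ hμ))
    {Ω : Type*} [MeasurableSpace Ω] (P : Measure Ω) [IsProbabilityMeasure P]
    (X : UHN → Ω → 𝓧) (hX : IsBranchingMarkovProcess P X Q μ)
    (f : 𝓧 → ℝ) (hf : MemLp f 2 μ) :
    -- The empirical average is square integrable and unbiased.
    (∀ A : Finset UHN, A.Nonempty →
      MemLp (empiricalAverage X f A) 2 P ∧
        ∫ ω, empiricalAverage X f A ω ∂P = ∫ x, f x ∂μ) ∧
    -- The Markov chain, and every other line graph, has minimal variance.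
    (∀ n : ℕ, 1 ≤ n →
      (UHN.markovLine n ∈ UHN.subtreesOfCard n ∧ UHN.IsLine (UHN.markovLine n)) ∧
      ∀ L ∈ UHN.subtreesOfCard n, UHN.IsLine L →
        IsMinOn (fun A => variance (empiricalAverage X f A) P) (UHN.subtreesOfCard n) L) ∧
    -- Uniqueness of the minimizer, up to graph isomorphism.
    (∀ n : ℕ, 5 ≤ n →
      ((∀ A ∈ UHN.subtreesOfCard n,
          IsMinOn (fun B => variance (empiricalAverage X f B) P) (UHN.subtreesOfCard n) A →
            UHN.IsLine A) ↔
        hf.toLp f ∉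
          LinearMap.ker (kernelOperator Q μ hμ).toLinearMap ⊔
          LinearMap.ker (kernelOperator Q μ hμ - 1).toLinearMap ⊔
          LinearMap.ker (kernelOperator Q μ hμ + 1).toLinearMap)) := by
  have hsym : (kernelOperator Q μ hμ : Lp ℝ 2 μ →ₗ[ℝ] Lp ℝ 2 μ).IsSymmetric :=
    ContinuousLinearMap.isSelfAdjoint_iff_isSymmetric.1 hsa
  have hnorm := norm_kernelOperator_le hμ
  have hmin : ∀ n : ℕ, 1 ≤ n → ∀ L ∈ UHN.subtreesOfCard n, UHN.IsLine L →
      IsMinOn (fun A => variance (empiricalAverage X f A) P) (UHN.subtreesOfCard n) L := by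
    rintro n hn L ⟨-, hLn⟩ hline A ⟨hA, hAn⟩
    have hLne : L.Nonempty := Finset.card_pos.1 (by omega)
    have hnn := inner_aeval_nonneg hcomp hsym hnorm (p := UHN.distPoly A - UHN.distPoly L)
      (fun a ha => by
        rw [Polynomial.eval_sub, UHN.eval_distPoly, UHN.eval_distPoly,
          hline.distSum_eq hLne a, sub_nonneg, hLn, ← hAn]
        exact UHN.pairSum_path_le_distSum hA (abs_le.1 ha).1 (abs_le.1 ha).2) (hf.toLp f)
    have := hX.variance_sub_variance hμ hsym hf hLne (hAn.trans hLn.symm)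
    exact sub_nonneg.1 (this ▸ mul_nonneg (sq_nonneg _) hnn)
  refine ⟨fun A hA => ⟨hX.memLp_empiricalAverage hμ hf A,
    hX.integral_empiricalAverage hμ hf hA⟩, fun n hn =>
    ⟨⟨UHN.markovLine_mem_subtreesOfCard hn, UHN.isLine_markovLine n⟩, hmin n hn⟩, fun n hn => ?_⟩
  have hL := UHN.markovLine_mem_subtreesOfCard (n := n) (by omega)
  have hline := UHN.isLine_markovLine n
  have hLn := UHN.card_markovLine n
  have hLne : (UHN.markovLine n).Nonempty := Finset.card_pos.1 (by omega)
  constructor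
  · intro h hker
    -- On the sum of the kernels a polynomial in `Q` depends only on its values at `0, 1, -1`, so
    -- this `A` has the variance of the line and is a minimizer.
    obtain ⟨A, hA, hnot, hsum⟩ := UHN.exists_not_isLine hn
    refine hnot (h A hA fun B hB => ?_)
    have hz := aeval_eq_zero_of_mem_ker (p := UHN.distPoly A - UHN.distPoly (UHN.markovLine n))
      (fun a ha => by
        rw [Polynomial.eval_sub, UHN.eval_distPoly, UHN.eval_distPoly,
          hline.distSum_eq hLne a, hLn, hsum a ha, sub_self]) hker
    have := hX.variance_sub_variance hμ hsym hf hLne (hA.2.trans hLn.symm)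
    rw [hz, inner_zero_right, mul_zero, sub_eq_zero] at this
    exact this.trans_le (hmin n (by omega) _ hL hline hB)
  · intro hker A hA hAmin
    by_contra hnot
    have hpoly : ∀ a, (UHN.distPoly A - UHN.distPoly (UHN.markovLine n)).eval a
        = UHN.distSum a A - BranchTree.pairSum a (BranchTree.path (A.card - 1)) := fun a => by
      rw [Polynomial.eval_sub, UHN.eval_distPoly, UHN.eval_distPoly, hline.distSum_eq hLne a, hLn,
        hA.2]
    have hpos := inner_aeval_pos hcomp hsym hnorm
      (fun a ha => by
        rw [hpoly, sub_nonneg]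
        exact UHN.pairSum_path_le_distSum hA.1 (abs_le.1 ha).1 (abs_le.1 ha).2)
      (fun a h1 h2 h0 => by
        rw [hpoly, sub_pos]
        exact UHN.pairSum_path_lt_distSum hA.1 hnot h1 h2 h0) hker
    have := hX.variance_sub_variance hμ hsym hf hLne (hA.2.trans hLn.symm)
    have hc : 0 < (((UHN.markovLine n).card : ℝ)⁻¹) ^ 2 := by
      have : 0 < (UHN.markovLine n).card := hLne.card_pos
      positivity
    exact absurd (hAmin hL) (not_le.2 (sub_pos.1 (this ▸ mul_pos hc hpos)))
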